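/- Let $\omega=(1+i\sqrt3)/2$ and $\mathbb T_6=\{\omega^k: k\in\mathbb Z\}$. A signed digraph $\Phi=(G,\varphi)$ is a finite simple graph $G$ together with a signature, i.e. a map $\varphi$ from the ordered pairs $(u,v)$ of adjacent vertices of $G$ to $\mathbb T_6$ with $\varphi(u,v)=\varphi(v,u)^{-1}$. Its Eisenstein matrix $\mathcal E(\Phi)$ is the Hermitian matrix with $\mathcal E_{uv}=\varphi(u,v)$ if $u,v$ are adjacent and $\mathcal E_{uv}=0$ otherwise; its eigenvalues are written $\lambda_1\ge\lambda_2\ge\dots\ge\lambda_n$. Two signed digraphs are switching isomorphic, $\Phi\sim\Phi'$, if $\Phi'$ is obtained from $\Phi$ by a sequence of vertex relabelings and gain switchings $\mathcal E\mapsto X\mathcal E X^{-1}$ ($X$ diagonal with diagonal entries in $\mathbb T_6$), possibly followed by taking the converse $\mathcal E\mapsto \mathcal E^{\top}$. Let $G$ be a clique expansion of the $5$-cycle: its vertex set is partitioned into five nonempty sets $C_1,\dots,C_5$ (indices modulo $5$), and two distinct vertices are adjacent if and only if they lie in the same $C_j$ or in $C_j$ and $C_{j+1}$ for some $j$. A signature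 $\varphi'$ on $G$ is said to be * of type A if, for some $k$, all edges between $C_k$ and $C_{k+1}$ have gain $-1$ and all other edges have gain $1$; * of type B if, for some $k$ and some distinct $a,b\in C_k$, it is obtained from the type A signature with the same $k$ by setting $\varphi'(a,b)=\omega$ and $\varphi'(b,a)=\omega^{-1}$ (so $C_k$ induces a $K^*$, a complete graph with exactly one oriented edge); * of type C if, for some $k$, $\varphi'(u,v)=-\omega$ and $\varphi'(v,u)=(-\omega)^{-1}$ for all $u\in C_k$, $v\in C_{k+1}$, and all other edges have gain $1$; * of type D if, for some $k$, $a\in C_k$ and $b\in C_{k+1}$, it is obtained from the type A signature with the same $k$ by setting $\varphi'(a,b)=-\omega$ and $\varphi'(b,a)=(-\omega)^{-1}$. **Proposition.** Let $G$ be a clique expansion of $C_5$ and let $\Phi=(G,\varphi)$ be a signed digraph with $\lambda_2>0>\lambda_3$. Then $\Phi\sim\Phi'=(G,\varphi')$ for some signature $\varphi'$ on $G$ that is of type A, B, C or D. -/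

import Mathlib

namespace SignedDigraph

/-- The primitive sixth root of unity `ω = (1 + i√3)/2`. -/
noncomputable def omega : ℂ := (1 + Complex.I * (Real.sqrt 3 : ℝ)) / 2

/-- The gain group `𝕋₆ = {ω ^ k}`. -/
def gainSet : Set ℂ := {z | ∃ k : ℕ, z = omega ^ k}

theorem norm_omega : ‖omega‖ = 1 := by
  have h : Complex.normSq omega = 1 := by
    have h3 : Real.sqrt 3 * Real.sqrt 3 = 3 := Real.mul_self_sqrt (by norm_num)
    simp only [omega, Complex.normSq_div, Complex.normSq_apply]
    simp
    nlinarith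
  rw [← Complex.sq_norm] at h
  nlinarith [norm_nonneg omega]

theorem inv_eq_star_of_mem_gainSet {z : ℂ} (hz : z ∈ gainSet) : z⁻¹ = star z := by
  obtain ⟨k, rfl⟩ := hz
  rw [Complex.star_def]
  exact Complex.inv_eq_conj (by rw [norm_pow, norm_omega, one_pow])

/-- A signature `φ` on the graph `G`: a `𝕋₆`-valued function on the arcs `uv` of `G` with
`φ(uv) = φ(vu)⁻¹`.  The signed digraph is the pair `(G, φ)`.  The values of `gain` on pairs of
non-adjacent vertices carry no information and are never used. -/
structure Signature {V : Type*} (G : SimpleGraph V) where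
  gain : V → V → ℂ
  gain_mem : ∀ u v, G.Adj u v → gain u v ∈ gainSet
  gain_inv : ∀ u v, G.Adj u v → gain u v = (gain v u)⁻¹

/-- The Eisenstein matrix of the signed digraph `(G, φ)`. -/
def Signature.eisenstein {V : Type*} {G : SimpleGraph V} [DecidableRel G.Adj]
    (φ : Signature G) : Matrix V V ℂ :=
  Matrix.of fun u v => if G.Adj u v then φ.gain u v else 0

theorem Signature.isHermitian {V : Type*} {G : SimpleGraph V} [DecidableRel G.Adj]
    (φ : Signature G) : φ.eisenstein.IsHermitian := by
  ext u v
  by_cases h : G.Adj u v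
  · have h' := h.symm
    simp only [Signature.eisenstein, Matrix.conjTranspose_apply, Matrix.of_apply, h, h', if_true]
    rw [φ.gain_inv u v h, inv_eq_star_of_mem_gainSet (φ.gain_mem v u h')]
  · have h' : ¬ G.Adj v u := fun q => h q.symm
    simp [Signature.eisenstein, h, h']

/-- With the eigenvalues `λ₁ ≥ λ₂ ≥ … ≥ λₙ` of the Eisenstein matrix listed in decreasing order
with multiplicity (`eigenvalues₀` is antitone and indexed from `0`): `λ₂ > 0 > λ₃`. -/
def Signature.SecondPosThirdNeg {V : Type*} [Fintype V] [DecidableEq V] {G : SimpleGraph V}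
    [DecidableRel G.Adj] (φ : Signature G) : Prop :=
  ∃ h : 2 < Fintype.card V,
    0 < φ.isHermitian.eigenvalues₀ ⟨1, by omega⟩ ∧ φ.isHermitian.eigenvalues₀ ⟨2, h⟩ < 0

/-- `B = X A X⁻¹` for a diagonal matrix `X` with diagonal entries in `𝕋₆`. -/
def IsGainSwitching {V : Type*} [Fintype V] [DecidableEq V] (A B : Matrix V V ℂ) : Prop :=
  ∃ x : V → ℂ, (∀ v, x v ∈ gainSet) ∧ B = Matrix.diagonal x * A * (Matrix.diagonal x)⁻¹

/-- Switching isomorphism: the second signed digraph arises from the first by a relabelling of the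
vertices and a gain switching, possibly followed by taking the converse.  The converse reverses all
arcs, that is, it transposes the Eisenstein matrix.  (Any sequence of such operations can be
brought into this form.) -/
def SwitchingIsomorphic {V : Type*} [Fintype V] [DecidableEq V] {G G' : SimpleGraph V}
    [DecidableRel G.Adj] [DecidableRel G'.Adj] (φ : Signature G) (φ' : Signature G') : Prop :=
  ∃ σ : Equiv.Perm V,
    IsGainSwitching (φ.eisenstein.submatrix σ σ) φ'.eisenstein ∨
      IsGainSwitching (φ.eisenstein.submatrix σ σ) φ'.eisenstein.transpose

/-- The clique expansion of a graph `H` with expansion vector `τ`: the vertex `i` is replaced by a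
clique of `τ i` vertices (lexicographic product of `H` with the complete graphs `K_{τ i}`). -/
def cliqueExpansion {ι : Type*} (H : SimpleGraph ι) (τ : ι → ℕ) :
    SimpleGraph (Σ i, Fin (τ i)) where
  Adj x y := x ≠ y ∧ (x.1 = y.1 ∨ H.Adj x.1 y.1)
  symm := ⟨fun _ _ h => ⟨h.1.symm, h.2.imp Eq.symm fun a => a.symm⟩⟩
  loopless := ⟨fun _ h => h.1 rfl⟩

section Types

/-! In the following, `G` is a clique expansion of the 5-cycle with cliques `C₀, …, C₄`, and
`c v` is the index of the clique that contains the vertex `v`; indices are taken modulo 5. -/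

/-- The gain `z` on every arc from `C_k` to `C_{k+1}` (and so `z⁻¹` on every arc from
`C_{k+1}` to `C_k`), and the gain `1` on all other arcs. -/
noncomputable def crossGain {V : Type*} (c : V → Fin 5) (k : Fin 5) (z : ℂ) (u v : V) : ℂ :=
  if c u = k ∧ c v = k + 1 then z else if c u = k + 1 ∧ c v = k then z⁻¹ else 1

/-- Type A: all gains are `1`, except that the edges between two consecutive cliques
`C_k`, `C_{k+1}` have gain `-1`. -/
def Signature.IsTypeA {V : Type*} {G : SimpleGraph V} (c : V → Fin 5) (φ : Signature G) : Prop :=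
  ∃ k : Fin 5, ∀ u v, G.Adj u v → φ.gain u v = crossGain c k (-1) u v

/-- Type B: as type A, except that a single edge `ab` inside the clique `C_k` is oriented, so that
`C_k` induces `K^*`. -/
def Signature.IsTypeB {V : Type*} [DecidableEq V] {G : SimpleGraph V} (c : V → Fin 5)
    (φ : Signature G) : Prop :=
  ∃ (k : Fin 5) (a b : V), a ≠ b ∧ c a = k ∧ c b = k ∧ ∀ u v, G.Adj u v →
    φ.gain u v = if u = a ∧ v = b then omega else if u = b ∧ v = a then omega⁻¹
      else crossGain c k (-1) u v

/-- Type C: all gains are `1`, except that the arcs from `C_k` to `C_{k+1}` have gain `-ω`. -/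
def Signature.IsTypeC {V : Type*} {G : SimpleGraph V} (c : V → Fin 5) (φ : Signature G) : Prop :=
  ∃ k : Fin 5, ∀ u v, G.Adj u v → φ.gain u v = crossGain c k (-omega) u v

/-- Type D: as type A, except that a single arc `ab` from `C_k` to `C_{k+1}` has gain `-ω`
instead of `-1`. -/
def Signature.IsTypeD {V : Type*} [DecidableEq V] {G : SimpleGraph V} (c : V → Fin 5)
    (φ : Signature G) : Prop :=
  ∃ (k : Fin 5) (a b : V), c a = k ∧ c b = k + 1 ∧ ∀ u v, G.Adj u v →
    φ.gain u v = if u = a ∧ v = b then -omega else if u = b ∧ v = a then (-omega)⁻¹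
      else crossGain c k (-1) u v

end Types

end SignedDigraph

/-! Since `λ₃ < 0`, the Hermitian form of the Eisenstein matrix has at most two nonnegative
eigenvalues. Take adjacent vertices `x ∈ C_{j+2}` and `y ∈ C_{j+3}`. They span a hyperbolic plane,
and splitting it off uses up one positive direction. The orthogonal complement is described by the
remaining cliques `C_{j-1}, C_j, C_{j+1}`, and the Schur complement fills in exactly the missing
entries between `C_{j-1}` and `C_{j+1}` with unit gains. So each window of three consecutive cliques
becomes a complete gain graph whose form is positive in at most one direction and negative on its
complement (`lorentzian_contract`).

Such complete gain graphs can be classified. Every triangle gain has positive real part, hence is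
`1`, `ω` or `ω⁻¹`. Small forbidden configurations then show that a balanced set of maximal size
misses at most one vertex, and that all nontrivial triangles share one edge (`balanced_or_star`). A
triangle that meets all three cliques of the window has gain minus that of a 5-cycle through `x` and
`y`. Translated back, this gives `LocalStar`: around every clique, the triangles and 5-cycles behave
as if all gains were trivial with cycle gain `-1`, up to one exceptional arc.

It remains to glue the five overlapping windows. If all pairs `C_i ∪ C_{i+1}` are balanced, only the
common gain of the 5-cycles matters, and this gives types A and C. Otherwise a single arc `ab`
accounts for every nontrivial triangle (`exists_edge_of_localStar`): inside one clique if all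
5-cycles have gain `-1` (type B), and between two consecutive cliques if not (type D). Dividing out
the gain of that arc reduces the switching argument to the balanced case. -/

namespace SignedDigraph

/-! ### Sesquilinear forms and inertia. -/

open Matrix

/-- The sesquilinear form `p* E q` of a matrix. -/
noncomputable def form {n : Type*} [Fintype n] (E : Matrix n n ℂ) (p q : n → ℂ) : ℂ :=
  star p ⬝ᵥ E *ᵥ q

section Form

variable {n : Type*} [Fintype n] (E : Matrix n n ℂ)

theorem form_add_right (p q r : n → ℂ) : form E p (q + r) = form E p q + form E p r := by
  simp [form, mulVec_add]

theorem form_add_left (p q r : n → ℂ) : form E (p + q) r = form E p r + form E q r := by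
  simp [form, add_dotProduct]

theorem form_smul_right (c : ℂ) (p q : n → ℂ) : form E p (c • q) = c * form E p q := by
  simp [form, mulVec_smul]

theorem form_smul_left (c : ℂ) (p q : n → ℂ) : form E (c • p) q = star c * form E p q := by
  simp [form, smul_dotProduct]

theorem form_sum_right {ι : Type*} (s : Finset ι) (p : n → ℂ) (q : ι → n → ℂ) :
    form E p (∑ i ∈ s, q i) = ∑ i ∈ s, form E p (q i) := by
  classical
  induction s using Finset.induction_on with
  | empty => simp [form]
  | insert a s ha ih => rw [Finset.sum_insert ha, Finset.sum_insert ha, form_add_right, ih]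

theorem form_sum_left {ι : Type*} (s : Finset ι) (p : ι → n → ℂ) (q : n → ℂ) :
    form E (∑ i ∈ s, p i) q = ∑ i ∈ s, form E (p i) q := by
  classical
  induction s using Finset.induction_on with
  | empty => simp [form]
  | insert a s ha ih => rw [Finset.sum_insert ha, Finset.sum_insert ha, form_add_left, ih]

theorem form_apply (p q : n → ℂ) : form E p q = ∑ i, ∑ j, star (p i) * E i j * q j := by
  simp [form, dotProduct, mulVec, Finset.mul_sum, mul_assoc]

theorem form_single [DecidableEq n] (i j : n) :
    form E (Pi.single i 1) (Pi.single j 1) = E i j := by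
  simp [form]

variable {E}

theorem form_swap (hE : E.IsHermitian) (p q : n → ℂ) : form E q p = star (form E p q) := by
  rw [form, form, ← star_dotProduct_star, star_mulVec, hE.eq, star_star, dotProduct_comm,
    ← dotProduct_mulVec, dotProduct_comm, dotProduct_comm]

end Form

/-- In a form with at most two nonnegative eigenvalues, a nonzero vector orthogonal to two
orthogonal positive vectors is negative. -/
theorem Signature.SecondPosThirdNeg.form_neg {V : Type*} [Fintype V] [DecidableEq V]
    {G : SimpleGraph V} [DecidableRel G.Adj] {φ : Signature G} (hφ : φ.SecondPosThirdNeg)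
    {p q r : V → ℂ} (hp : 0 < (form φ.eisenstein p p).re) (hq : 0 < (form φ.eisenstein q q).re)
    (hpq : form φ.eisenstein p q = 0) (hpr : form φ.eisenstein p r = 0)
    (hqr : form φ.eisenstein q r = 0) (hr : r ≠ 0) : (form φ.eisenstein r r).re < 0 := by
  classical
  obtain ⟨hcard, -, hneg⟩ := hφ
  have hE := φ.isHermitian
  set E := φ.eisenstein
  by_contra! hrr
  let σ := Fintype.equivOfCardEq (Fintype.card_fin (Fintype.card V))
  let U : Matrix V V ℂ := hE.eigenvectorUnitary
  have hdiag : ∀ z : V → ℂ, (form E z z).re =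
      ∑ i, hE.eigenvalues i * Complex.normSq ((Uᴴ *ᵥ z) i) := by
    intro z
    have h1 : E = U * diagonal (RCLike.ofReal ∘ hE.eigenvalues) * Uᴴ := by
      conv_lhs => rw [hE.spectral_theorem, Unitary.conjStarAlgAut_apply]
      rfl
    have h2 : form E z z = ∑ i, ((hE.eigenvalues i * Complex.normSq ((Uᴴ *ᵥ z) i) : ℝ) : ℂ) := by
      conv_lhs => rw [form, h1]
      rw [← mulVec_mulVec, ← mulVec_mulVec, dotProduct_mulVec,
        show star z ᵥ* U = star (Uᴴ *ᵥ z) by rw [star_mulVec, conjTranspose_conjTranspose]]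
      simp only [dotProduct, mulVec_diagonal]
      refine Finset.sum_congr rfl fun i _ => ?_
      rw [Complex.ofReal_mul, Complex.normSq_eq_conj_mul_self]
      simp only [Pi.star_apply, Function.comp_apply, Complex.star_def,
        Complex.coe_algebraMap]
      ring
    rw [h2, ← Complex.ofReal_sum, Complex.ofReal_re]
  let i0 : V := σ ⟨0, by omega⟩
  let i1 : V := σ ⟨1, by omega⟩
  have hev : ∀ i, i ≠ i0 → i ≠ i1 → hE.eigenvalues i < 0 := by
    intro i h0 h1
    refine lt_of_le_of_lt (hE.eigenvalues₀_antitone (?_ : (⟨2, hcard⟩ : Fin _) ≤ σ.symm i)) hneg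
    rw [Fin.le_def]
    have a0 : (σ.symm i).val ≠ 0 := fun h => h0 (by
      rw [← σ.apply_symm_apply i]; exact congrArg σ (Fin.ext h))
    have a1 : (σ.symm i).val ≠ 1 := fun h => h1 (by
      rw [← σ.apply_symm_apply i]; exact congrArg σ (Fin.ext h))
    change 2 ≤ _
    omega
  -- Two linear equations in three unknowns: some nontrivial combination of `p, q, r` has no
  -- component along the eigenvectors `i0` and `i1`, so the form is nonpositive on it.
  obtain ⟨a, ha, ha0⟩ : ∃ a : Fin 3 → ℂ, a ≠ 0 ∧ ∀ i, (i = i0 ∨ i = i1) →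
      (Uᴴ *ᵥ (a 0 • p + a 1 • q + a 2 • r)) i = 0 := by
    let f : (Fin 3 → ℂ) →ₗ[ℂ] (Fin 2 → ℂ) := Matrix.mulVecLin
      !![(Uᴴ *ᵥ p) i0, (Uᴴ *ᵥ q) i0, (Uᴴ *ᵥ r) i0; (Uᴴ *ᵥ p) i1, (Uᴴ *ᵥ q) i1, (Uᴴ *ᵥ r) i1]
    have hf : LinearMap.ker f ≠ ⊥ := LinearMap.ker_ne_bot_of_finrank_lt (by simp)
    obtain ⟨a, ha, hne⟩ := (Submodule.ne_bot_iff _).1 hf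
    refine ⟨a, hne, ?_⟩
    have h0 := congrFun (LinearMap.mem_ker.1 ha) 0
    have h1 := congrFun (LinearMap.mem_ker.1 ha) 1
    simp [f, Matrix.mulVec, dotProduct, Fin.sum_univ_three] at h0 h1
    rintro i (rfl | rfl) <;>
    simp only [mulVec_add, mulVec_smul, Pi.add_apply, Pi.smul_apply, smul_eq_mul] <;>
    simp only [Matrix.mulVec, dotProduct, conjTranspose_apply, RCLike.star_def]
    · rw [← h0]; ring
    · rw [← h1]; ring
  set z := a 0 • p + a 1 • q + a 2 • r with hz
  have hqp := form_swap hE p q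
  have hrp := form_swap hE p r
  have hrq := form_swap hE q r
  rw [hpq, star_zero] at hqp
  rw [hpr, star_zero] at hrp
  rw [hqr, star_zero] at hrq
  have hzz : form E z z = Complex.normSq (a 0) * form E p p + Complex.normSq (a 1) * form E q q
      + Complex.normSq (a 2) * form E r r := by
    rw [hz]
    simp only [form_add_left, form_add_right, form_smul_left, form_smul_right, hpq, hpr, hqr,
      hqp, hrp, hrq, Complex.normSq_eq_conj_mul_self, Complex.star_def]
    ring
  have hre : 0 ≤ (form E z z).re := by
    rw [hzz]
    simp only [Complex.add_re, Complex.re_ofReal_mul]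
    have := Complex.normSq_nonneg (a 0)
    have := Complex.normSq_nonneg (a 1)
    have := Complex.normSq_nonneg (a 2)
    positivity
  have hterm : ∀ i, hE.eigenvalues i * Complex.normSq ((Uᴴ *ᵥ z) i) ≤ 0 := by
    intro i
    by_cases h : i = i0 ∨ i = i1
    · rw [ha0 i h]; simp
    · push Not at h
      exact mul_nonpos_of_nonpos_of_nonneg (hev i h.1 h.2).le (Complex.normSq_nonneg _)
  have hzero : Uᴴ *ᵥ z = 0 := by
    funext i
    by_cases h : i = i0 ∨ i = i1
    · exact ha0 i h
    · rw [hdiag] at hre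
      have h1 := (Finset.sum_eq_zero_iff_of_nonpos fun i _ => hterm i).1
        (le_antisymm (Finset.sum_nonpos fun i _ => hterm i) hre) i (Finset.mem_univ i)
      push Not at h
      rcases mul_eq_zero.1 h1 with h2 | h2
      · exact absurd h2 (hev i h.1 h.2).ne
      · exact Complex.normSq_eq_zero.1 h2
  have hz0 : z = 0 := by
    have h1 : U *ᵥ (Uᴴ *ᵥ z) = z := by
      rw [mulVec_mulVec, show U * Uᴴ = 1 from Unitary.mul_star_self_of_mem hE.eigenvectorUnitary.2,
        one_mulVec]
    rw [← h1, hzero, mulVec_zero]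
  -- Linear independence of `p, q, r` is not assumed; pairing `z = 0` with `p` and `q` gives it.
  have e0 : form E p z = 0 := by rw [hz0]; simp [form]
  have e1 : form E q z = 0 := by rw [hz0]; simp [form]
  simp only [hz, form_add_right, form_smul_right, hpq, hpr, hqp, hqr] at e0 e1
  have n0 : form E p p ≠ 0 := fun h => by simp [h] at hp
  have n1 : form E q q ≠ 0 := fun h => by simp [h] at hq
  have a0 : a 0 = 0 := by simpa [n0] using e0
  have a1 : a 1 = 0 := by simpa [n1] using e1
  have a2 : a 2 = 0 := by simpa [hz, a0, a1, hr] using hz0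
  apply ha
  funext i
  fin_cases i <;> assumption


/-! ### Arithmetic of the sixth roots of unity. -/

theorem omega_re : omega.re = 1 / 2 := by
  simp [omega]

theorem omega_im : omega.im = Real.sqrt 3 / 2 := by
  simp [omega]

theorem omega_mul_self : omega * omega = omega - 1 := by
  have h3 : Real.sqrt 3 * Real.sqrt 3 = 3 := Real.mul_self_sqrt (by norm_num)
  apply Complex.ext
  · simp only [Complex.mul_re, Complex.sub_re, omega_re, omega_im, Complex.one_re]
    linarith
  · simp only [Complex.mul_im, Complex.sub_im, omega_re, omega_im, Complex.one_im]
    linarith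

theorem star_omega : star omega = 1 - omega := by
  apply Complex.ext
  · simp [omega_re]; norm_num
  · simp [omega_im]

theorem omega_ne_zero : omega ≠ 0 := fun h => by
  have := norm_omega
  simp [h] at this

theorem omega_inv : omega⁻¹ = 1 - omega :=
  inv_eq_of_mul_eq_one_right (by linear_combination -omega_mul_self)

theorem one_sub_omega_inv : (1 - omega)⁻¹ = omega := by
  rw [← omega_inv, inv_inv]

/-- Equality of Eisenstein numbers is equality of their coordinates. -/
theorem eisenstein_eq_zero {a b : ℝ} (h : (a : ℂ) + b * omega = 0) : a = 0 ∧ b = 0 := by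
  have him := congrArg Complex.im h
  have hre := congrArg Complex.re h
  simp [omega_im, omega_re] at him hre
  subst him
  simpa using hre

theorem omega_ne_one : omega ≠ 1 := fun h => by
  have := congrArg Complex.re h
  rw [omega_re] at this
  norm_num at this

theorem one_sub_omega_ne_one : 1 - omega ≠ 1 := fun h =>
  omega_ne_zero (by linear_combination -h)

theorem one_mem_gainSet : (1 : ℂ) ∈ gainSet := ⟨0, by simp⟩

theorem omega_mem_gainSet : omega ∈ gainSet := ⟨1, by simp⟩

theorem mul_mem_gainSet {x y : ℂ} (hx : x ∈ gainSet) (hy : y ∈ gainSet) : x * y ∈ gainSet := by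
  obtain ⟨k, rfl⟩ := hx
  obtain ⟨l, rfl⟩ := hy
  exact ⟨k + l, (pow_add _ _ _).symm⟩

theorem neg_one_mem_gainSet : (-1 : ℂ) ∈ gainSet :=
  ⟨3, by linear_combination -(omega + 1) * omega_mul_self⟩

theorem neg_mem_gainSet {x : ℂ} (hx : x ∈ gainSet) : -x ∈ gainSet := by
  simpa using mul_mem_gainSet neg_one_mem_gainSet hx

theorem omega_pow_six : omega ^ 6 = 1 := by
  have h : omega ^ 3 = -1 := by linear_combination (omega + 1) * omega_mul_self
  calc omega ^ 6 = (omega ^ 3) ^ 2 := by ring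
    _ = 1 := by rw [h]; norm_num

theorem inv_mem_gainSet {x : ℂ} (hx : x ∈ gainSet) : x⁻¹ ∈ gainSet := by
  obtain ⟨k, rfl⟩ := hx
  refine ⟨5 * k, inv_eq_of_mul_eq_one_left ?_⟩
  rw [← pow_add, show 5 * k + k = 6 * k by ring, pow_mul, omega_pow_six, one_pow]

theorem ne_zero_of_mem_gainSet {x : ℂ} (hx : x ∈ gainSet) : x ≠ 0 := by
  obtain ⟨k, rfl⟩ := hx
  exact pow_ne_zero _ omega_ne_zero

theorem gainSet_of_re_pos {t : ℂ} (ht : t ∈ gainSet) (hre : 0 < t.re) :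
    t = 1 ∨ t = omega ∨ t = 1 - omega := by
  obtain ⟨k, rfl⟩ := ht
  have hk : omega ^ k = omega ^ (k % 6) := by
    conv_lhs => rw [← Nat.div_add_mod k 6, pow_add, pow_mul, omega_pow_six, one_pow, one_mul]
  rw [hk] at hre ⊢
  have hlt : k % 6 < 6 := Nat.mod_lt _ (by norm_num)
  have h2 : omega ^ 2 = omega - 1 := by rw [sq, omega_mul_self]
  have h3 : omega ^ 3 = -1 := by linear_combination (omega + 1) * omega_mul_self
  have h4 : omega ^ 4 = -omega := by linear_combination omega * h3
  have h5 : omega ^ 5 = 1 - omega := by linear_combination omega ^ 2 * h3 - h2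
  generalize k % 6 = m at *
  interval_cases m
  · simp
  · simp
  · rw [h2] at hre; simp [omega_re] at hre; norm_num at hre
  · rw [h3] at hre; norm_num at hre
  · rw [h4] at hre; simp [omega_re] at hre; norm_num at hre
  · simp [h5]

/-! ### Triangle gains and forbidden configurations in Lorentzian gain graphs. -/

/-- A gain function on the complete graph with vertex set `W`, with the value `1` on the
diagonal. -/
structure IsGain {W : Type*} (g : W → W → ℂ) : Prop where
  diag : ∀ u, g u u = 1
  mem : ∀ u v, g u v ∈ gainSet
  inv : ∀ u v, g u v * g v u = 1

/-- The gain of the closed walk `u v w u`. -/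
noncomputable def tri {W : Type*} (g : W → W → ℂ) (u v w : W) : ℂ := g u v * g v w * g w u

theorem tri_rotate {W : Type*} {g : W → W → ℂ} (u v w : W) : tri g u v w = tri g v w u := by
  rw [tri, tri]; ring

/-- The hermitian form of the complete gain graph has (on every finite set of vertices) at most one
nonnegative eigenvalue. -/
def Lorentzian {W : Type*} (g : W → W → ℂ) : Prop :=
  ∀ (k : ℕ) (w : Fin k → W), Function.Injective w → ∀ p q : Fin k → ℂ,
    0 < (form (Matrix.of fun i j => if i = j then 0 else g (w i) (w j)) p p).re →
    form (Matrix.of fun i j => if i = j then 0 else g (w i) (w j)) p q = 0 → q ≠ 0 →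
    (form (Matrix.of fun i j => if i = j then 0 else g (w i) (w j)) q q).re < 0

namespace IsGain

variable {W : Type*} {g : W → W → ℂ} (hg : IsGain g)
include hg

theorem star_eq (u v : W) : star (g u v) = g v u := by
  rw [← inv_eq_star_of_mem_gainSet (hg.mem u v)]
  exact inv_eq_of_mul_eq_one_right (hg.inv u v)

theorem tri_mem (u v w : W) : tri g u v w ∈ gainSet :=
  mul_mem_gainSet (mul_mem_gainSet (hg.mem _ _) (hg.mem _ _)) (hg.mem _ _)

theorem star_tri (u v w : W) : star (tri g u v w) = tri g u w v := by
  simp only [tri, star_mul', hg.star_eq]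
  ring

theorem tri_mul_tri_swap (u v w : W) : tri g u v w * tri g u w v = 1 := by
  rw [tri, tri]
  linear_combination g v w * g w u * g u w * g w v * hg.inv u v
    + g w u * g u w * hg.inv v w + hg.inv w u

theorem tri_left (u w : W) : tri g u u w = 1 := by
  rw [tri, hg.diag, one_mul, hg.inv]

theorem tri_right (u w : W) : tri g u w w = 1 := by
  rw [tri, hg.diag, mul_one, hg.inv]

theorem tri_outer (u w : W) : tri g u w u = 1 := by
  rw [tri, hg.diag, mul_one, hg.inv]

theorem tri_cocycle (a b u v : W) :
    tri g a b u * tri g a u v = tri g a b v * tri g b u v := by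
  have h1 := hg.inv u a
  have h2 := hg.inv v b
  simp only [tri]
  linear_combination g a b * g b u * g u v * g v a * h1 - g a b * g b u * g u v * g v a * h2

end IsGain

/-- Switching by the gains towards `w 0` replaces each entry by the triangle gain through `w 0` and
leaves the form unchanged. The Lorentzian condition can therefore be tested on a matrix `N` of
triangle gains, whose row `0` is `1` off the diagonal. -/
theorem Lorentzian.normalized {W : Type*} {g : W → W → ℂ} (hL : Lorentzian g) (hg : IsGain g)
    {k : ℕ} (w : Fin (k + 1) → W) (hw : Function.Injective w)
    (N : Matrix (Fin (k + 1)) (Fin (k + 1)) ℂ) (hN : N.IsHermitian) (hdiag : ∀ i, N i i = 0)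
    (htri : ∀ i j, i < j → tri g (w 0) (w i) (w j) = N i j) {p q : Fin (k + 1) → ℂ}
    (hp : 0 < (form N p p).re) (hpq : form N p q = 0) (hq : q ≠ 0) : (form N q q).re < 0 := by
  have htri' : ∀ i j, i ≠ j → tri g (w 0) (w i) (w j) = N i j := by
    intro i j hij
    rcases lt_or_gt_of_ne hij with h | h
    · exact htri i j h
    · rw [← hN.apply, ← htri j i h, hg.star_tri]
  have hform : ∀ p q : Fin (k + 1) → ℂ,
      form (Matrix.of fun i j => if i = j then 0 else g (w i) (w j))
        (fun i => g (w i) (w 0) * p i) (fun i => g (w i) (w 0) * q i) = form N p q := by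
    intro p q
    rw [form_apply, form_apply]
    refine Finset.sum_congr rfl fun i _ => Finset.sum_congr rfl fun j _ => ?_
    by_cases hij : i = j
    · subst hij; simp [hdiag]
    · rw [Matrix.of_apply, if_neg hij, ← htri' i j hij, tri, star_mul', hg.star_eq]
      ring
  rw [← hform]
  refine hL _ w hw _ _ ?_ ((hform p q).trans hpq) fun h => hq ?_
  · rw [hform]; exact hp
  · funext i
    have := congrFun h i
    simpa [ne_zero_of_mem_gainSet (hg.mem _ _)] using this

theorem Lorentzian.tri_re_pos {W : Type*} {g : W → W → ℂ} (hL : Lorentzian g) (hg : IsGain g)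
    {a b c : W} (hab : a ≠ b) (hac : a ≠ c) (hbc : b ≠ c) : 0 < (tri g a b c).re := by
  have h := hL.normalized hg ![a, b, c] (by
      intro i j h; fin_cases i <;> fin_cases j <;> simp_all)
    !![0, 1, 1; 1, 0, tri g a b c; 1, star (tri g a b c), 0]
    (by ext i j; fin_cases i <;> fin_cases j <;> simp)
    (by intro i; fin_cases i <;> simp)
    (by intro i j; fin_cases i <;> fin_cases j <;> simp [hg.tri_left])
    -- `q` is annihilated by the first two rows, so it is orthogonal to `p`, and its value is minus
    -- twice the real part of the triangle gain.
    (p := ![1, 1, 0]) (q := ![-tri g a b c, -1, 1])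
    (by simp [form_apply, Fin.sum_univ_three])
    (by simp [form_apply, Fin.sum_univ_three])
    (fun h => by simpa using congrFun h 1)
  simp [form_apply, Fin.sum_univ_three] at h
  linarith

theorem Lorentzian.tri_cases {W : Type*} {g : W → W → ℂ} (hL : Lorentzian g) (hg : IsGain g)
    (a b c : W) : tri g a b c = 1 ∨ tri g a b c = omega ∨ tri g a b c = 1 - omega := by
  by_cases hab : a = b
  · subst hab; exact Or.inl (hg.tri_left _ _)
  by_cases hac : a = c
  · subst hac; exact Or.inl (hg.tri_outer _ _)
  by_cases hbc : b = c
  · subst hbc; exact Or.inl (hg.tri_right _ _)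
  exact gainSet_of_re_pos (hg.tri_mem _ _ _) (hL.tri_re_pos hg hab hac hbc)

/-- Let `s, s', r` be the gains of `abu, abv, auv`. If all three were nontrivial, eliminating `a`
and `b` would leave a `2 × 2` form with diagonal `-1` and off-diagonal entry `x = r - s' - star s`.
Negativity requires `|x| < 1`, but `|x|² - 1` is always `0` or `6`. -/
theorem Lorentzian.tri_eq_one_of_four {W : Type*} {g : W → W → ℂ} (hL : Lorentzian g)
    (hg : IsGain g) {a b u v : W} (hab : a ≠ b) (hau : a ≠ u) (hav : a ≠ v) (hbu : b ≠ u)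
    (hbv : b ≠ v) (huv : u ≠ v) (h1 : tri g a b u ≠ 1) (h2 : tri g a b v ≠ 1) :
    tri g a u v = 1 := by
  by_contra h3
  have t1 := (hL.tri_cases hg a b u).resolve_left h1
  have t2 := (hL.tri_cases hg a b v).resolve_left h2
  have t3 := (hL.tri_cases hg a u v).resolve_left h3
  have h := fun q : Fin 4 → ℂ => hL.normalized hg ![a, b, u, v] (by
      intro i j h; fin_cases i <;> fin_cases j <;> simp_all)
    !![0, 1, 1, 1; 1, 0, tri g a b u, tri g a b v;
      1, star (tri g a b u), 0, tri g a u v; 1, star (tri g a b v), star (tri g a u v), 0]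
    (by ext i j; fin_cases i <;> fin_cases j <;> simp)
    (by intro i; fin_cases i <;> simp)
    (by intro i j; fin_cases i <;> fin_cases j <;> simp [hg.tri_left])
    (p := ![1, 1, 0, 0]) (q := q)
    (by simp [form_apply, Fin.sum_univ_four])
  generalize tri g a b u = s at *
  generalize tri g a b v = s' at *
  generalize tri g a u v = r at *
  have hs : star s = 1 - s := by
    rcases t1 with rfl | rfl <;> simp [star_omega]
  have hs' : star s' = 1 - s' := by
    rcases t2 with rfl | rfl <;> simp [star_omega]
  have hr : star r = 1 - r := by
    rcases t3 with rfl | rfl <;> simp [star_omega]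
  have cs : (starRingEnd ℂ) s = 1 - s := hs
  have cs' : (starRingEnd ℂ) s' = 1 - s' := hs'
  have cr : (starRingEnd ℂ) r = 1 - r := hr
  rw [hs, hs', hr] at h
  -- With `x` as above this is `x • (-s, -1, 1, 0) + (-s', -1, 0, 1)`; both vectors are annihilated
  -- by the first two rows, and the value of the form is `|x|² - 1`.
  have h := h ![-(r - s' - (1 - s)) * s - s', -(r - s' - (1 - s)) - 1, r - s' - (1 - s), 1]
    (by simp [form_apply, Fin.sum_univ_four]; ring)
    (fun h => by simpa using congrFun h 3)
  rw [show form _ _ _ = (s' - r - s) * (r - s' - 1 + s) - 1 by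
    simp [form_apply, Fin.sum_univ_four, cs, cs', cr]
    ring] at h
  have hval : (s' - r - s) * (r - s' - 1 + s) - 1 = 0 ∨
      (s' - r - s) * (r - s' - 1 + s) - 1 = 6 := by
    have hw := omega_mul_self
    rcases t1 with rfl | rfl <;> rcases t2 with rfl | rfl <;> rcases t3 with rfl | rfl <;>
      first
        | (left; linear_combination -hw)
        | (right; linear_combination -9 * hw)
  rcases hval with hv | hv <;> rw [hv] at h <;> norm_num at h

/-- The matrix of this five-vertex configuration is singular. It excludes a vertex `s` that sees a
balanced quadruple split into two pairs. -/
theorem Lorentzian.not_split_four {W : Type*} {g : W → W → ℂ} (hL : Lorentzian g)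
    (hg : IsGain g) {a b u v s : W} (hd : [a, b, u, v, s].Nodup)
    (h1 : tri g a b u = 1) (h2 : tri g a b v = 1) (h3 : tri g a u v = 1)
    (h4 : tri g a b s = 1) {t : ℂ} (ht : t = omega ∨ t = 1 - omega)
    (h5 : tri g a u s = t) (h6 : tri g a v s = t) : False := by
  have hst : star t = 1 - t := by
    rcases ht with rfl | rfl <;> simp [star_omega]
  have hct : (starRingEnd ℂ) t = 1 - t := hst
  have htt : t * t = t - 1 := by
    rcases ht with rfl | rfl <;> linear_combination omega_mul_self
  have h := hL.normalized hg ![a, b, u, v, s] (by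
      simp only [List.nodup_cons, List.mem_cons, List.not_mem_nil, or_false, not_or] at hd
      intro i j h; fin_cases i <;> fin_cases j <;> simp_all)
    !![0, 1, 1, 1, 1; 1, 0, 1, 1, 1; 1, 1, 0, 1, t; 1, 1, 1, 0, t; 1, 1, star t, star t, 0]
    (by ext i j; fin_cases i <;> fin_cases j <;> simp)
    (by intro i; fin_cases i <;> simp)
    (by intro i j; fin_cases i <;> fin_cases j <;> simp [hg.tri_left, *])
    -- `q` is a kernel vector of the matrix, by `t * star t = 1` and `t + star t = 1`.
    (p := ![1, 1, 0, 0, 0]) (q := ![1 - 2 * t, 1 - 2 * t, t - 2, t - 2, 3])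
    (by simp [form_apply, Fin.sum_univ_five])
    (by simp [form_apply, Fin.sum_univ_five]; ring)
    (fun h => by simpa using congrFun h 4)
  rw [show form _ _ _ = (0 : ℂ) by
    simp [form_apply, Fin.sum_univ_five, hct, map_ofNat]
    linear_combination -6 * htt] at h
  simp at h

/-- Again a singular five-vertex matrix. The configuration arises when two vertices outside a
balanced set have different odd vertices in it. -/
theorem Lorentzian.not_pentagon {W : Type*} {g : W → W → ℂ} (hL : Lorentzian g)
    (hg : IsGain g) {q p p' s s' : W} (hd : [q, p, p', s, s'].Nodup) {t : ℂ}
    (ht : t = omega ∨ t = 1 - omega)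
    (h1 : tri g q p p' = 1) (h2 : tri g q s p = t) (h3 : tri g q s p' = 1)
    (h4 : tri g q s' p = 1) (h5 : tri g q p' s' = t) (h6 : tri g q s s' = t) : False := by
  have hinj : Function.Injective ![q, p, p', s, s'] := by
    simp only [List.nodup_cons, List.mem_cons, List.not_mem_nil, or_false, not_or] at hd
    clear h1 h2 h3 h4 h5 h6
    intro i j h
    fin_cases i <;> fin_cases j <;> simp_all
  have hst : star t = 1 - t := by
    rcases ht with rfl | rfl <;> simp [star_omega]
  have hct : (starRingEnd ℂ) t = 1 - t := hst
  have htt : t * t = t - 1 := by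
    rcases ht with rfl | rfl <;> linear_combination omega_mul_self
  have h2' : tri g q p s = star t := by rw [← hg.star_tri, h2]
  have h3' : tri g q p' s = 1 := by rw [← hg.star_tri, h3, star_one]
  have h4' : tri g q p s' = 1 := by rw [← hg.star_tri, h4, star_one]
  have h := hL.normalized hg ![q, p, p', s, s'] hinj
    !![0, 1, 1, 1, 1; 1, 0, 1, star t, 1; 1, 1, 0, 1, t; 1, t, 1, 0, t; 1, 1, star t, star t, 0]
    (by ext i j; fin_cases i <;> fin_cases j <;> simp)
    (by intro i; fin_cases i <;> simp)
    (by intro i j; fin_cases i <;> fin_cases j <;> simp [hg.tri_left, h1, h2', h3', h4', h5, h6])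
    -- A kernel vector, by `t + star t = 1` and `t * t = t - 1`.
    (p := ![1, 1, 0, 0, 0]) (q := ![-t, 1 - t, -1, t - 1, 1])
    (by simp [form_apply, Fin.sum_univ_five])
    (by simp [form_apply, Fin.sum_univ_five, hct]; linear_combination -htt)
    (fun h => by simpa using congrFun h 4)
  rw [show form _ _ _ = (0 : ℂ) by
    simp [form_apply, Fin.sum_univ_five, hct]
    linear_combination -htt] at h
  simp at h


/-! ### Maximal balanced sets. -/

/-- All triangles in `S` have gain `1`. -/
def Balanced {W : Type*} (g : W → W → ℂ) (S : Finset W) : Prop :=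
  ∀ u ∈ S, ∀ v ∈ S, ∀ w ∈ S, tri g u v w = 1

theorem IsGain.tri_swap_eq_one {W : Type*} {g : W → W → ℂ} (hg : IsGain g) {u v w : W}
    (h : tri g u v w = 1) : tri g u w v = 1 := by
  rw [← hg.star_tri, h, star_one]

theorem Balanced.insert {W : Type*} [DecidableEq W] {g : W → W → ℂ} (hg : IsGain g)
    {S : Finset W} (hS : Balanced g S) {s : W}
    (hs : ∀ u ∈ S, ∀ v ∈ S, tri g s u v = 1) : Balanced g (insert s S) := by
  intro u hu v hv w hw
  rw [Finset.mem_insert] at hu hv hw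
  rcases hu with rfl | hu
  · rcases hv with rfl | hv
    · exact hg.tri_left _ _
    · rcases hw with rfl | hw
      · exact hg.tri_outer _ _
      · exact hs v hv w hw
  · rcases hv with rfl | hv
    · rcases hw with rfl | hw
      · exact hg.tri_right _ _
      · rw [tri_rotate]; exact hs w hw u hu
    · rcases hw with rfl | hw
      · rw [tri_rotate, tri_rotate]; exact hs u hu v hv
      · exact hS u hu v hv w hw

/-- On a balanced `B` the gains `tri g s x y` are multiplicative in `x, y`, so their being `1` is an
equivalence relation. By `tri_eq_one_of_four` there are at most two classes, and by `not_split_four`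
one of them is a single vertex `p`. -/
theorem Lorentzian.exists_odd_vertex {W : Type*} {g : W → W → ℂ} (hL : Lorentzian g)
    (hg : IsGain g) {B : Finset W} (hB : Balanced g B) {s : W} (hs : s ∉ B)
    (hex : ∃ p ∈ B, ∃ p' ∈ B, tri g s p p' ≠ 1) :
    ∃ p ∈ B, (∀ q ∈ B, ∀ q' ∈ B, q ≠ p → q' ≠ p → tri g s q q' = 1) ∧
      ∃ t, (t = omega ∨ t = 1 - omega) ∧ ∀ q ∈ B, q ≠ p → tri g s p q = t := by
  obtain ⟨p, hp, p', hp', hne⟩ := hex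
  have hne' : ∀ x ∈ B, s ≠ x := fun x hx h => hs (h ▸ hx)
  have hpp' : p ≠ p' := fun h => hne (h ▸ hg.tri_right _ _)
  have hco : ∀ x ∈ B, ∀ y ∈ B, ∀ z ∈ B, tri g s x y * tri g s y z = tri g s x z := by
    intro x hx y hy z hz
    rw [hg.tri_cocycle, hB x hx y hy z hz, mul_one]
  have hsw : ∀ x y, tri g s x y ≠ 1 → tri g s y x ≠ 1 :=
    fun x y h h' => h (hg.tri_swap_eq_one h')
  have hfour : ∀ x ∈ B, ∀ y ∈ B, ∀ z ∈ B, y ≠ z → tri g s x y ≠ 1 → tri g s x z ≠ 1 →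
      tri g s y z = 1 := by
    intro x hx y hy z hz hyz h1 h2
    exact hL.tri_eq_one_of_four hg (hne' x hx) (hne' y hy) (hne' z hz)
      (fun h => h1 (h ▸ hg.tri_right _ _)) (fun h => h2 (h ▸ hg.tri_right _ _)) hyz h1 h2
  have hclass : ∀ x ∈ B, ∀ x' ∈ B, tri g s x x' ≠ 1 →
      (∀ q ∈ B, q ≠ x → tri g s q x' = 1) →
      (∀ q ∈ B, ∀ q' ∈ B, q ≠ x → q' ≠ x → tri g s q q' = 1) ∧
        ∃ t, (t = omega ∨ t = 1 - omega) ∧ ∀ q ∈ B, q ≠ x → tri g s x q = t := by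
    intro x hx x' hx' hxx' h
    refine ⟨fun q hq q' hq' hqx hqx' => ?_, tri g s x x',
      (hL.tri_cases hg s x x').resolve_left hxx', fun q hq hqx => ?_⟩
    · rw [← hco q hq x' hx' q' hq', h q hq hqx, hg.tri_swap_eq_one (h q' hq' hqx'), mul_one]
    · rw [← hco x hx x' hx' q hq, hg.tri_swap_eq_one (h q hq hqx), mul_one]
  by_cases h1 : ∀ q ∈ B, q ≠ p → tri g s q p' = 1
  · exact ⟨p, hp, hclass p hp p' hp' hne h1⟩
  by_cases h2 : ∀ q ∈ B, q ≠ p' → tri g s q p = 1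
  · exact ⟨p', hp', hclass p' hp' p hp (hsw _ _ hne) h2⟩
  exfalso
  push Not at h1 h2
  obtain ⟨q, hq, hqp, hqp'⟩ := h1
  obtain ⟨q', hq', hq'p', hq'p⟩ := h2
  -- Neither class is a singleton: `q` belongs to the class of `p`, and `q'` to that of `p'`.
  have e1 : tri g s p q = 1 :=
    hfour p' hp' p hp q hq hqp.symm (hsw _ _ hne) (hsw _ _ hqp')
  have e2 : tri g s p' q' = 1 := hfour p hp p' hp' q' hq' hq'p'.symm hne (hsw _ _ hq'p)
  have hqq' : q ≠ q' := by
    rintro rfl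
    exact hq'p (hg.tri_swap_eq_one e1)
  have hqp'' : q ≠ p' := fun h => hqp' (h ▸ hg.tri_right _ _)
  have hq'p'' : q' ≠ p := fun h => hq'p (h ▸ hg.tri_right _ _)
  have r1 : ∀ x y, tri g s x y = tri g x y s := fun x y => tri_rotate _ _ _
  have e3 : tri g s p q' = tri g s p p' := by rw [← hco p hp p' hp' q' hq', e2, mul_one]
  exact hL.not_split_four hg (a := p) (b := q) (u := p') (v := q') (s := s)
    (by
      simp [(hne' p hp).symm, (hne' q hq).symm, (hne' p' hp').symm, (hne' q' hq').symm,
        hpp', hq'p''.symm, hqp'', hqq', hq'p'.symm, hqp.symm])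
    (hB _ hp _ hq _ hp') (hB _ hp _ hq _ hq') (hB _ hp _ hp' _ hq')
    (by rw [← r1, e1]) ((hL.tri_cases hg s p p').resolve_left hne) (r1 _ _).symm
    (by rw [← r1, e3])

/-- The squares of `ω` and `ω⁻¹` have negative real part, so they are not admissible triangle gains.
-/
theorem omega_mul_ne {t t' : ℂ} (ht : t = omega ∨ t = 1 - omega)
    (ht' : t' = omega ∨ t' = 1 - omega)
    (h : t * t' = 1 ∨ t * t' = omega ∨ t * t' = 1 - omega) : t * t' = 1 := by
  have hw := omega_mul_self
  rcases ht with rfl | rfl <;> rcases ht' with rfl | rfl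
  · exfalso
    rcases h with h | h | h
    · have := eisenstein_eq_zero (a := -2) (b := 1) (by push_cast; linear_combination h - hw)
      norm_num at this
    · have := eisenstein_eq_zero (a := -1) (b := 0) (by push_cast; linear_combination h - hw)
      norm_num at this
    · have := eisenstein_eq_zero (a := -2) (b := 2) (by push_cast; linear_combination h - hw)
      norm_num at this
  · linear_combination -hw
  · linear_combination -hw
  · exfalso
    rcases h with h | h | h
    · have := eisenstein_eq_zero (a := -1) (b := -1) (by push_cast; linear_combination h - hw)
      norm_num at this
    · have := eisenstein_eq_zero (a := 0) (b := -2) (by push_cast; linear_combination h - hw)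
      norm_num at this
    · have := eisenstein_eq_zero (a := -1) (b := 0) (by push_cast; linear_combination h - hw)
      norm_num at this

theorem ne_one_of_cases {t : ℂ} (ht : t = omega ∨ t = 1 - omega) : t ≠ 1 := by
  rcases ht with rfl | rfl
  · exact omega_ne_one
  · exact one_sub_omega_ne_one

theorem inv_cases {t : ℂ} (ht : t = omega ∨ t = 1 - omega) : t⁻¹ = omega ∨ t⁻¹ = 1 - omega := by
  rcases ht with rfl | rfl
  · exact Or.inr omega_inv
  · exact Or.inl one_sub_omega_inv

theorem mem_gainSet_of_cases {t : ℂ} (ht : t = omega ∨ t = 1 - omega) : t ∈ gainSet := by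
  rcases ht with rfl | rfl
  · exact omega_mem_gainSet
  · rw [← omega_inv]; exact inv_mem_gainSet omega_mem_gainSet

/-- If `B` is a balanced set of maximal size, then there is at most one vertex outside `B`. -/
theorem Lorentzian.eq_of_notMem_maximal {W : Type*} [DecidableEq W] {g : W → W → ℂ}
    (hL : Lorentzian g) (hg : IsGain g) {B : Finset W} (hB : Balanced g B)
    (hmax : ∀ S : Finset W, Balanced g S → S.card ≤ B.card) (h3 : 3 ≤ B.card) {s s' : W}
    (hs : s ∉ B) (hs' : s' ∉ B) : s = s' := by
  by_contra hss
  have hex : ∀ x, x ∉ B → ∃ p ∈ B, ∃ p' ∈ B, tri g x p p' ≠ 1 := by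
    intro x hx
    by_contra! h
    have := hmax _ (hB.insert hg h)
    rw [Finset.card_insert_of_notMem hx] at this
    omega
  have hne : ∀ x ∈ B, s ≠ x := fun x hx h => hs (h ▸ hx)
  have hne' : ∀ x ∈ B, s' ≠ x := fun x hx h => hs' (h ▸ hx)
  obtain ⟨p, hp, hp1, t, ht, hpt⟩ := hL.exists_odd_vertex hg hB hs (hex s hs)
  obtain ⟨p', hp', hp1', t', ht', hpt'⟩ := hL.exists_odd_vertex hg hB hs' (hex s' hs')
  by_cases hpp : p = p'
  · subst hpp
    have hone : ∀ q ∈ B, q ≠ p → tri g s s' q = 1 := by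
      intro q hq hqp
      by_contra hh
      have c := hg.tri_cocycle s s' p q
      rw [hpt q hq hqp, hpt' q hq hqp] at c
      have h1 : tri g s s' p = 1 := by
        by_contra h1
        have := hL.tri_eq_one_of_four hg hss (hne p hp) (hne q hq) (hne' p hp) (hne' q hq)
          hqp.symm h1 hh
        rw [hpt q hq hqp] at this
        exact ne_one_of_cases ht this
      rw [h1, one_mul] at c
      have hh' := (hL.tri_cases hg s s' q).resolve_left hh
      have := omega_mul_ne hh' ht' (by rw [← c]; exact Or.inr ht)
      rw [← c] at this
      exact ne_one_of_cases ht this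
    -- With a common odd vertex `p`, exchanging `p` for both `s` and `s'` gives a larger balanced
    -- set.
    have hBp : Balanced g (B.erase p) := fun u hu v hv w hw =>
      hB u (Finset.mem_of_mem_erase hu) v (Finset.mem_of_mem_erase hv) w
        (Finset.mem_of_mem_erase hw)
    have hb1 := hBp.insert hg (s := s') fun u hu v hv =>
      hp1' u (Finset.mem_of_mem_erase hu) v (Finset.mem_of_mem_erase hv)
        (Finset.ne_of_mem_erase hu) (Finset.ne_of_mem_erase hv)
    have hb2 := hb1.insert hg (s := s) (by
      intro u hu v hv
      rw [Finset.mem_insert] at hu hv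
      rcases hu with rfl | hu <;> rcases hv with rfl | hv
      · exact hg.tri_right _ _
      · exact hone v (Finset.mem_of_mem_erase hv) (Finset.ne_of_mem_erase hv)
      · exact hg.tri_swap_eq_one
          (hone u (Finset.mem_of_mem_erase hu) (Finset.ne_of_mem_erase hu))
      · exact hp1 u (Finset.mem_of_mem_erase hu) v (Finset.mem_of_mem_erase hv)
          (Finset.ne_of_mem_erase hu) (Finset.ne_of_mem_erase hv))
    have hc := hmax _ hb2
    have n1 : s' ∉ B.erase p := fun h => hs' (Finset.mem_of_mem_erase h)
    have n2 : s ∉ insert s' (B.erase p) := by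
      rw [Finset.mem_insert, not_or]
      exact ⟨hss, fun h => hs (Finset.mem_of_mem_erase h)⟩
    rw [Finset.card_insert_of_notMem n2, Finset.card_insert_of_notMem n1,
      Finset.card_erase_of_mem hp] at hc
    omega
  · obtain ⟨q, hq, hqp, hqp'⟩ : ∃ q ∈ B, q ≠ p ∧ q ≠ p' := by
      have : (({p, p'} : Finset W)).card < B.card := lt_of_le_of_lt Finset.card_le_two h3
      obtain ⟨q, hq, hqn⟩ := Finset.exists_mem_notMem_of_card_lt_card this
      exact ⟨q, hq, by simpa using hqn⟩
    have hpp' : p' ≠ p := fun h => hpp h.symm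
    have c1 := hg.tri_cocycle s s' p q
    have c2 := hg.tri_cocycle s s' p' q
    have e1 := hpt q hq hqp
    have e2 := hpt p' hp' hpp'
    have e3 := hpt' q hq hqp'
    have e4 := hpt' p hp hpp
    have e5 := hp1 p' hp' q hq hpp' hqp
    have e6 := hp1' p hp q hq hpp hqp'
    rw [e1, e6, mul_one] at c1
    rw [e5, e3, mul_one] at c2
    have key : tri g s s' p = 1 ∨ tri g s s' p' = 1 := by
      by_contra! h
      have := hL.tri_eq_one_of_four hg hss (hne p hp) (hne p' hp') (hne' p hp) (hne' p' hp')
        hpp h.1 h.2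
      rw [e2] at this
      exact ne_one_of_cases ht this
    -- In either case the cocycle relations together with `omega_mul_ne` force the gains of the
    -- pentagon configuration.
    have hfin : tri g s s' q = t ∧ t * t' = 1 := by
      rcases key with h | h
      · rw [h, one_mul] at c1
        refine ⟨c1.symm, omega_mul_ne ht ht' ?_⟩
        rw [c1, ← c2]
        exact hL.tri_cases hg _ _ _
      · rw [h] at c2
        have h1 := omega_mul_ne ht' (t' := tri g s s' q)
          ((hL.tri_cases hg s s' q).resolve_left (fun hh => by
            rw [hh, one_mul] at c2
            exact ne_one_of_cases ht' c2.symm)) (Or.inl (by rw [c2]; ring))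
        have h2 : tri g s s' p * t * t' = 1 := by rw [c1, ← c2]
        have ht0 := ne_zero_of_mem_gainSet (mem_gainSet_of_cases ht)
        have ht0' := ne_zero_of_mem_gainSet (mem_gainSet_of_cases ht')
        have h3 : tri g s s' p = t⁻¹ * t'⁻¹ := by
          field_simp
          linear_combination h2
        have h4 := omega_mul_ne (inv_cases ht) (inv_cases ht') (by
          rw [← h3]; exact hL.tri_cases hg _ _ _)
        have h5 : t * t' = 1 := by
          field_simp at h4
          linear_combination -h4
        refine ⟨?_, h5⟩
        calc tri g s s' q = (t' * tri g s s' q) * t := by linear_combination -(tri g s s' q) * h5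
          _ = t := by rw [h1, one_mul]
    obtain ⟨hh, htt⟩ := hfin
    have ht0 := ne_zero_of_mem_gainSet (mem_gainSet_of_cases ht)
    refine hL.not_pentagon hg (q := q) (p := p) (p' := p') (s := s) (s' := s') ?_ ht
      (hB _ hq _ hp _ hp') ?_ ?_ ?_ ?_ ?_
    · simp [(hne p hp).symm, (hne q hq).symm, (hne p' hp').symm, (hne' p hp).symm,
        (hne' q hq).symm, (hne' p' hp').symm, hqp, hqp', hpp, hss]
    · rw [tri_rotate, e1]
    · rw [tri_rotate, e5]
    · rw [tri_rotate, e6]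
    · have := hg.tri_mul_tri_swap s' p' q
      rw [e3] at this
      rw [tri_rotate, tri_rotate, ← mul_right_inj' (ne_zero_of_mem_gainSet
        (mem_gainSet_of_cases ht')), this, mul_comm, htt]
    · rw [tri_rotate, hh]

/-- A finite Lorentzian gain graph is balanced, or it becomes balanced after the change of the
gain of one edge. -/
theorem Lorentzian.balanced_or_star {W : Type*} [Finite W] {g : W → W → ℂ}
    (hL : Lorentzian g) (hg : IsGain g) :
    (∀ u v w, tri g u v w = 1) ∨ ∃ a b t, a ≠ b ∧ (t = omega ∨ t = 1 - omega) ∧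
      (∀ w, w ≠ a → w ≠ b → tri g a b w = t) ∧
      ∀ u v w, (u ≠ a ∧ v ≠ a ∧ w ≠ a) ∨ (u ≠ b ∧ v ≠ b ∧ w ≠ b) → tri g u v w = 1 := by
  classical
  let _ := Fintype.ofFinite W
  obtain ⟨B, hBmem, hmax'⟩ := Finset.exists_max_image
    (Finset.univ.filter fun S : Finset W => Balanced g S) Finset.card
    ⟨∅, Finset.mem_filter.2 ⟨Finset.mem_univ _, by simp [Balanced]⟩⟩
  have hB : Balanced g B := (Finset.mem_filter.1 hBmem).2
  have hmax : ∀ S : Finset W, Balanced g S → S.card ≤ B.card := fun S hS =>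
    hmax' S (Finset.mem_filter.2 ⟨Finset.mem_univ _, hS⟩)
  by_cases hall : ∀ x, x ∈ B
  · exact Or.inl fun u v w => hB u (hall u) v (hall v) w (hall w)
  right
  push Not at hall
  obtain ⟨s, hs⟩ := hall
  have hex : ∃ p ∈ B, ∃ p' ∈ B, tri g s p p' ≠ 1 := by
    by_contra! h
    have := hmax _ (hB.insert hg h)
    rw [Finset.card_insert_of_notMem hs] at this
    omega
  have huniq : ∀ x, x ∉ B → x = s := by
    intro x hx
    by_contra hxs
    rcases le_or_gt 3 B.card with h3 | h3
    · exact hxs (hL.eq_of_notMem_maximal hg hB hmax h3 hx hs)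
    obtain ⟨p, hp, p', hp', hne⟩ := hex
    -- If a maximal balanced set has fewer than three vertices, no triangle on distinct vertices is
    -- trivial; with four vertices this contradicts `tri_eq_one_of_four`.
    have hsm : ∀ a b c : W, a ≠ b → a ≠ c → b ≠ c → tri g a b c ≠ 1 := by
      intro a b c hab hac hbc h
      have hb : Balanced g {b, c} := by
        intro u hu v hv w hw
        simp only [Finset.mem_insert, Finset.mem_singleton] at hu hv hw
        rcases hu with rfl | rfl <;> rcases hv with rfl | rfl <;> rcases hw with rfl | rfl <;>
          simp only [hg.tri_left, hg.tri_right, hg.tri_outer]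
      have := hmax _ (hb.insert hg (s := a) (by
        intro u hu v hv
        simp only [Finset.mem_insert, Finset.mem_singleton] at hu hv
        rcases hu with rfl | rfl <;> rcases hv with rfl | rfl
        · exact hg.tri_right _ _
        · exact h
        · exact hg.tri_swap_eq_one h
        · exact hg.tri_right _ _))
      rw [Finset.card_insert_of_notMem (by simp [hab, hac]), Finset.card_pair hbc] at this
      omega
    have hpp : p ≠ p' := fun h => hne (h ▸ hg.tri_right _ _)
    have n1 : s ≠ p := fun h => hs (h ▸ hp)
    have n2 : s ≠ p' := fun h => hs (h ▸ hp')
    have n3 : x ≠ p := fun h => hx (h ▸ hp)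
    have n4 : x ≠ p' := fun h => hx (h ▸ hp')
    exact hsm _ _ _ hxs n4 n2 (hL.tri_eq_one_of_four hg n3 hxs n4 n1.symm hpp n2
      (hsm _ _ _ n3 hxs n1.symm) (hsm _ _ _ n3 n4 hpp))
  obtain ⟨p, hp, hp1, t, ht, hpt⟩ := hL.exists_odd_vertex hg hB hs hex
  have hmem : ∀ x, x ≠ s → x ∈ B := fun x hx => by
    by_contra h
    exact hx (huniq x h)
  refine ⟨s, p, t, fun h => hs (h ▸ hp), ht, fun w hws hwp => hpt w (hmem w hws) hwp, ?_⟩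
  rintro u v w (⟨hu, hv, hw⟩ | ⟨hu, hv, hw⟩)
  · exact hB u (hmem u hu) v (hmem v hv) w (hmem w hw)
  · have hBp : Balanced g (B.erase p) := fun u hu v hv w hw =>
      hB u (Finset.mem_of_mem_erase hu) v (Finset.mem_of_mem_erase hv) w
        (Finset.mem_of_mem_erase hw)
    have hb := hBp.insert hg (s := s) fun u hu v hv =>
      hp1 u (Finset.mem_of_mem_erase hu) v (Finset.mem_of_mem_erase hv)
        (Finset.ne_of_mem_erase hu) (Finset.ne_of_mem_erase hv)
    have hm : ∀ x, x ≠ p → x ∈ insert s (B.erase p) := by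
      intro x hx
      by_cases hxs : x = s
      · rw [hxs]; exact Finset.mem_insert_self _ _
      · exact Finset.mem_insert_of_mem (Finset.mem_erase.2 ⟨hx, hmem x hxs⟩)
    exact hb u (hm u hu) v (hm v hv) w (hm w hw)


/-! ### Elimination of two adjacent vertices. -/

theorem form_gram {n : Type*} [Fintype n] (E : Matrix n n ℂ) {k : ℕ} (f : Fin k → n → ℂ)
    (p q : Fin k → ℂ) : form E (∑ i, p i • f i) (∑ i, q i • f i) =
      form (Matrix.of fun i j => form E (f i) (f j)) p q := by
  rw [form_sum_left, form_apply]
  refine Finset.sum_congr rfl fun i _ => ?_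
  rw [form_sum_right]
  refine Finset.sum_congr rfl fun j _ => ?_
  rw [form_smul_left, form_smul_right, Matrix.of_apply]
  ring

/-- The gain function of a signature, with the value `1` on pairs of nonadjacent vertices. -/
noncomputable def Signature.fullGain {V : Type*} {G : SimpleGraph V} [DecidableRel G.Adj]
    (φ : Signature G) (u v : V) : ℂ := if G.Adj u v then φ.gain u v else 1

theorem Signature.isGain_fullGain {V : Type*} {G : SimpleGraph V} [DecidableRel G.Adj]
    (φ : Signature G) : IsGain φ.fullGain where
  diag u := by simp [fullGain]
  mem u v := by
    unfold fullGain
    split_ifs with h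
    · exact φ.gain_mem u v h
    · exact one_mem_gainSet
  inv u v := by
    unfold fullGain
    by_cases h : G.Adj u v
    · rw [if_pos h, if_pos h.symm, φ.gain_inv u v h]
      exact inv_mul_cancel₀ (ne_zero_of_mem_gainSet (φ.gain_mem v u h.symm))
    · rw [if_neg h, if_neg fun q => h q.symm, one_mul]

theorem Signature.eisenstein_apply {V : Type*} {G : SimpleGraph V} [DecidableRel G.Adj]
    (φ : Signature G) (u v : V) :
    φ.eisenstein u v = if G.Adj u v then φ.fullGain u v else 0 := by
  by_cases h : G.Adj u v <;> simp [eisenstein, fullGain, h]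

/-- `G` is a clique expansion of the 5-cycle with cliques `c ⁻¹ {j}`. -/
def IsExpansion {V : Type*} (G : SimpleGraph V) (c : V → Fin 5) : Prop :=
  ∀ u v, G.Adj u v ↔ u ≠ v ∧ (c u = c v ∨ c v = c u + 1 ∨ c u = c v + 1)

/-- The gains of the complete graph on the cliques `C_{j-1}`, `C_j`, `C_{j+1}` that remains after
the vertices `x` and `y` in `C_{j+2}` and `C_{j+3}` are eliminated. -/
noncomputable def contract {V : Type*} (g : V → V → ℂ) (c : V → Fin 5) (j : Fin 5) (x y : V)
    (u v : V) : ℂ :=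
  if c u = j + 4 ∧ c v = j + 1 then -(g u y * g y x * g x v)
  else if c u = j + 1 ∧ c v = j + 4 then -(g u x * g x y * g y v) else g u v

theorem isGain_contract {V : Type*} {g : V → V → ℂ} (hg : IsGain g) (c : V → Fin 5) (j : Fin 5)
    (x y : V) : IsGain (contract g c j x y) where
  diag u := by
    have : ∀ i j : Fin 5, ¬(i = j + 4 ∧ i = j + 1) := by decide
    rw [contract, if_neg (this _ _), if_neg fun h => this _ _ h.symm, hg.diag]
  mem u v := by
    unfold contract
    have := hg.mem
    split_ifs <;> first
      | exact hg.mem u v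
      | exact neg_mem_gainSet (mul_mem_gainSet (mul_mem_gainSet (this _ _) (this _ _)) (this _ _))
  inv u v := by
    have h14 : ∀ j : Fin 5, j + 1 ≠ j + 4 := by decide
    unfold contract
    by_cases h1 : c u = j + 4 ∧ c v = j + 1
    · have h2 : ¬(c v = j + 4 ∧ c u = j + 1) := fun h => h14 j (h1.2.symm.trans h.1)
      rw [if_pos h1, if_neg h2, if_pos h1.symm]
      linear_combination g y x * g x v * g v x * g x y * hg.inv u y
        + g y x * g x y * hg.inv x v + hg.inv y x
    · by_cases h2 : c u = j + 1 ∧ c v = j + 4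
      · rw [if_neg h1, if_pos h2, if_pos h2.symm]
        linear_combination g x y * g y v * g v y * g y x * hg.inv u x
          + g x y * g y x * hg.inv y v + hg.inv x y
      · rw [if_neg h1, if_neg h2, if_neg fun h => h2 h.symm, if_neg fun h => h1 h.symm, hg.inv]

/-- The three consecutive cliques around `C_j`. -/
abbrev Window {V : Type*} (c : V → Fin 5) (j : Fin 5) : Type _ :=
  {v : V // c v = j + 4 ∨ c v = j ∨ c v = j + 1}

/-- The Gram matrix of the projections of the window vertices orthogonal to the plane of `x` and `y`
is the contracted gain matrix. That plane contains a positive vector, so `form_neg` applies to it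
together with one positive vector from the complement. -/
theorem Signature.SecondPosThirdNeg.lorentzian_contract {V : Type*} [Fintype V] [DecidableEq V]
    {G : SimpleGraph V} [DecidableRel G.Adj] {φ : Signature G} (hφ : φ.SecondPosThirdNeg)
    {c : V → Fin 5} (hc : IsExpansion G c) {j : Fin 5} {x y : V} (hx : c x = j + 2)
    (hy : c y = j + 3) :
    Lorentzian fun u v : Window c j => contract φ.fullGain c j x y u v := by
  intro k w hw p q hp hpq hq
  have hg := φ.isGain_fullGain
  have hE := φ.isHermitian
  have hEa := φ.eisenstein_apply
  set g := φ.fullGain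
  set E := φ.eisenstein
  have fin1 : ∀ j : Fin 5, j + 3 = j + 2 + 1 := by decide
  have fin2 : ∀ j : Fin 5, ¬(j + 4 = j + 2 ∨ j + 2 = j + 4 + 1 ∨ j + 4 = j + 2 + 1) := by decide
  have fin3 : ∀ j : Fin 5, ¬(j = j + 2 ∨ j + 2 = j + 1 ∨ j = j + 2 + 1) := by decide
  have fin4 : ∀ j : Fin 5, j + 2 = j + 1 + 1 := by decide
  have fin5 : ∀ j : Fin 5, j + 4 = j + 3 + 1 := by decide
  have fin6 : ∀ j : Fin 5, ¬(j = j + 3 ∨ j + 3 = j + 1 ∨ j = j + 3 + 1) := by decide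
  have fin7 : ∀ j : Fin 5, ¬(j + 1 = j + 3 ∨ j + 3 = j + 1 + 1 ∨ j + 1 = j + 3 + 1) := by decide
  have fin8 : ∀ j : Fin 5, j + 4 ≠ j + 2 ∧ j ≠ j + 2 ∧ j + 1 ≠ j + 2 := by decide
  have fin9 : ∀ j : Fin 5, j + 4 ≠ j + 3 ∧ j ≠ j + 3 ∧ j + 1 ≠ j + 3 := by decide
  have fin10 : ∀ j : Fin 5, ¬(j + 4 = j + 1 ∨ j + 1 = j + 4 + 1 ∨ j + 4 = j + 1 + 1) := by decide
  have fin11 : ∀ j : Fin 5, j = j + 4 + 1 := by decide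
  have fin12 : ∀ j : Fin 5, j + 4 ≠ j ∧ j + 4 ≠ j + 1 ∧ j + 1 ≠ j + 4 ∧ j ≠ j + 1 := by decide
  have hxy : x ≠ y := fun h => by
    have : ∀ j : Fin 5, j + 2 ≠ j + 3 := by decide
    exact this j (by rw [← hx, ← hy, h])
  have axy : G.Adj x y := (hc x y).2 ⟨hxy, Or.inr (Or.inl (by rw [hx, hy, fin1]))⟩
  have hwx : ∀ i, (w i : V) ≠ x := fun i h => by
    have := (w i).2
    rw [h, hx] at this
    rcases this with h | h | h
    · exact (fin8 j).1 h.symm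
    · exact (fin8 j).2.1 h.symm
    · exact (fin8 j).2.2 h.symm
  have hwy : ∀ i, (w i : V) ≠ y := fun i h => by
    have := (w i).2
    rw [h, hy] at this
    rcases this with h | h | h
    · exact (fin9 j).1 h.symm
    · exact (fin9 j).2.1 h.symm
    · exact (fin9 j).2.2 h.symm
  let e : V → V → ℂ := fun v => Pi.single v 1
  have hee : ∀ u v, form E (e u) (e v) = E u v := fun u v => form_single E u v
  -- The component of `e (w i)` orthogonal to `e x` and `e y`; the form on their plane has zero
  -- diagonal and unit off-diagonal entries.
  let f : Fin k → V → ℂ := fun i =>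
    e (w i) + (-(E y (w i) * g x y)) • e x + (-(E x (w i) * g y x)) • e y
  have Exx : E x x = 0 := by rw [hEa, if_neg (G.irrefl)]
  have Eyy : E y y = 0 := by rw [hEa, if_neg (G.irrefl)]
  have Exy : E x y = g x y := by rw [hEa, if_pos axy]
  have Eyx : E y x = g y x := by rw [hEa, if_pos axy.symm]
  have hfx : ∀ i, form E (e x) (f i) = 0 := fun i => by
    simp only [f, form_add_right, form_smul_right, hee, Exx, Exy]
    linear_combination -E x (w i) * hg.inv x y
  have hfy : ∀ i, form E (e y) (f i) = 0 := fun i => by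
    simp only [f, form_add_right, form_smul_right, hee, Eyy, Eyx]
    linear_combination -E y (w i) * hg.inv y x
  have hgram : (Matrix.of fun i i' => form E (f i) (f i')) =
      Matrix.of fun i i' => if i = i' then 0 else contract g c j x y (w i) (w i') := by
    ext i i'
    have h1 : form E (f i) (f i') = form E (e (w i)) (f i') := by
      conv_lhs => rw [show f i = e (w i) + (-(E y (w i) * g x y)) • e x
        + (-(E x (w i) * g y x)) • e y from rfl]
      rw [form_add_left, form_add_left, form_smul_left, form_smul_left, hfx, hfy]
      ring
    have h2 : form E (f i) (f i') = E (w i) (w i') - E (w i) x * g x y * E y (w i')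
        - E (w i) y * g y x * E x (w i') := by
      rw [h1]
      simp only [f, form_add_right, form_smul_right, hee]
      ring
    rw [Matrix.of_apply, Matrix.of_apply, h2]
    -- Within the window `x` sees only `C_{j+1}` and `y` only `C_{j-1}`, so the correction affects
    -- just the pairs between these two cliques, where `E` vanishes.
    have key : ∀ u v : Window c j, E u v - E u x * g x y * E y v - E u y * g y x * E x v =
        if u = v then 0 else contract g c j x y u v := by
      rintro ⟨u, hu⟩ ⟨v, hv⟩
      have dx : ∀ u, c u = j + 4 ∨ c u = j → E u x = 0 ∧ E x u = 0 := by
        intro u hu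
        have : ¬ G.Adj u x := by
          rw [hc, hx]
          rintro ⟨-, h⟩
          rcases hu with hu | hu <;> rw [hu] at h
          · exact fin2 j h
          · exact fin3 j h
        exact ⟨by rw [hEa, if_neg this], by rw [hEa, if_neg fun h => this h.symm]⟩
      have dy : ∀ u, c u = j ∨ c u = j + 1 → E u y = 0 ∧ E y u = 0 := by
        intro u hu
        have : ¬ G.Adj u y := by
          rw [hc, hy]
          rintro ⟨-, h⟩
          rcases hu with hu | hu <;> rw [hu] at h
          · exact fin6 j h
          · exact fin7 j h
        exact ⟨by rw [hEa, if_neg this], by rw [hEa, if_neg fun h => this h.symm]⟩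
      have ax : ∀ u, c u = j + 1 → E u x = g u x ∧ E x u = g x u := by
        intro u hu
        have : G.Adj u x := (hc u x).2 ⟨fun h => (fin8 j).2.2 (by rw [← hu, ← hx, h]),
          Or.inr (Or.inl (by rw [hu, hx, fin4]))⟩
        exact ⟨by rw [hEa, if_pos this], by rw [hEa, if_pos this.symm]⟩
      have ay : ∀ u, c u = j + 4 → E u y = g u y ∧ E y u = g y u := by
        intro u hu
        have : G.Adj u y := (hc u y).2 ⟨fun h => (fin9 j).1 (by rw [← hu, ← hy, h]),
          Or.inr (Or.inr (by rw [hu, hy, fin5]))⟩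
        exact ⟨by rw [hEa, if_pos this], by rw [hEa, if_pos this.symm]⟩
      have same : ∀ u v, (c u = c v ∨ c v = c u + 1 ∨ c u = c v + 1) →
          E u v = if u = v then 0 else g u v := by
        intro u v h
        rw [hEa]
        by_cases huv : u = v
        · rw [if_neg (by rw [huv]; exact G.irrefl), if_pos huv]
        · rw [if_pos ((hc u v).2 ⟨huv, h⟩), if_neg huv]
      have far : ∀ u v, c u = j + 4 → c v = j + 1 → E u v = 0 ∧ E v u = 0 ∧ u ≠ v := by
        intro u v hu hv
        have : ¬ G.Adj u v := by
          rw [hc, hu, hv]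
          exact fun h => fin10 j h.2
        exact ⟨by rw [hEa, if_neg this], by rw [hEa, if_neg fun h => this h.symm],
          fun h => (fin12 j).2.1 (by rw [← hu, ← hv, h])⟩
      obtain ⟨n1, n2, n3, n4⟩ := fin12 j
      simp only [Subtype.mk.injEq, contract]
      rcases hu with hu | hu | hu <;> rcases hv with hv | hv | hv
      · rw [same u v (by rw [hu, hv]; simp), (dx u (Or.inl hu)).1, (dx v (Or.inl hv)).2]
        simp [hu, hv, n2]
      · rw [same u v (by rw [hu, hv, ← fin11]; simp), (dx u (Or.inl hu)).1, (dx v (Or.inr hv)).2]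
        simp [hu, hv, n4]
      · obtain ⟨h1, h2, h3⟩ := far u v hu hv
        rw [h1, (dx u (Or.inl hu)).1, (ay u hu).1, (ax v hv).2]
        simp [hu, hv, h3]
      · rw [same u v (by rw [hu, hv, ← fin11]; simp), (dx u (Or.inr hu)).1, (dx v (Or.inl hv)).2]
        simp [hu, hv, n4]
      · rw [same u v (by rw [hu, hv]; simp), (dx u (Or.inr hu)).1, (dx v (Or.inr hv)).2]
        simp [hu, hv, n4]
      · rw [same u v (by rw [hu, hv]; simp), (dx u (Or.inr hu)).1, (dy u (Or.inl hu)).1]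
        simp [hu, hv, n1.symm, n4]
      · obtain ⟨h1, h2, h3⟩ := far v u hv hu
        rw [h2, (ax u hu).1, (dx v (Or.inl hv)).2, (ay v hv).2]
        simp [hu, hv, h3.symm, n3]
      · rw [same u v (by rw [hu, hv]; simp), (dy v (Or.inl hv)).2, (dy u (Or.inr hu)).1]
        simp [hu, hv, n3, n1.symm]
      · rw [same u v (by rw [hu, hv]; simp), (dy v (Or.inr hv)).2, (dy u (Or.inr hu)).1]
        simp [hu, hv, n3]
    rw [key]
    simp only [hw.eq_iff]
  let r : V → ℂ := e x + g y x • e y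
  have hrr : form E r r = 2 := by
    simp only [r, form_add_left, form_add_right, form_smul_left, form_smul_right, hee, Exx, Exy,
      Eyx, Eyy, hg.star_eq]
    linear_combination 2 * hg.inv x y
  have hrf : ∀ p : Fin k → ℂ, form E r (∑ i, p i • f i) = 0 := fun p => by
    rw [form_sum_right]
    refine Finset.sum_eq_zero fun i _ => ?_
    simp only [r, form_smul_right, form_add_left, form_smul_left, hfx, hfy]
    ring
  rw [← hgram] at hp hpq ⊢
  rw [← form_gram] at hp hpq ⊢
  refine hφ.form_neg (p := r) (by change 0 < (form E r r).re; rw [hrr]; norm_num) hp (hrf p)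
    (hrf q) hpq fun h => hq ?_
  -- As `x` and `y` lie outside the window, the coordinate of the combination at `w i` is `q i`.
  funext i
  have h1 := congrFun h (w i : V)
  have h2 : ∀ i', (f i') (w i) = if i = i' then 1 else 0 := by
    intro i'
    simp only [f, e, Pi.add_apply, Pi.smul_apply, smul_eq_mul, Pi.single_apply, hwx, hwy,
      if_false, mul_zero, add_zero]
    refine if_congr ?_ rfl rfl
    rw [Subtype.coe_inj, hw.eq_iff]
  simpa [Finset.sum_apply, h2] using h1


/-! ### Gain functions with a single nontrivial edge. -/

/-- The gain function that is `1` except for the gain `t` on the arc `ab`. -/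
noncomputable def edgeGain {V : Type*} [DecidableEq V] (a b : V) (t : ℂ) (u v : V) : ℂ :=
  if u = a ∧ v = b then t else if u = b ∧ v = a then t⁻¹ else 1

section EdgeGain

variable {V : Type*} [DecidableEq V] {a b : V} {t : ℂ}

theorem edgeGain_swap (hab : a ≠ b) : edgeGain b a t⁻¹ = edgeGain a b t := by
  funext u v
  unfold edgeGain
  by_cases h1 : u = a ∧ v = b
  · have h2 : ¬(u = b ∧ v = a) := fun h => hab (h1.1.symm.trans h.1)
    rw [if_neg h2, if_pos h1, if_pos h1, inv_inv]
  · simp only [h1, if_false]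

theorem isGain_edgeGain (hab : a ≠ b) (ht : t ∈ gainSet) : IsGain (edgeGain a b t) where
  diag u := by
    have h1 : ¬(u = a ∧ u = b) := fun h => hab (h.1.symm.trans h.2)
    rw [edgeGain, if_neg h1, if_neg fun h => h1 h.symm]
  mem u v := by
    unfold edgeGain
    split_ifs
    · exact ht
    · exact inv_mem_gainSet ht
    · exact one_mem_gainSet
  inv u v := by
    have ht0 := ne_zero_of_mem_gainSet ht
    unfold edgeGain
    by_cases h1 : u = a ∧ v = b
    · have h2 : ¬(v = a ∧ u = b) := fun h => hab (h.1.symm.trans h1.2)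
      rw [if_pos h1, if_neg h2, if_pos h1.symm, mul_inv_cancel₀ ht0]
    · by_cases h2 : u = b ∧ v = a
      · rw [if_neg h1, if_pos h2, if_pos h2.symm, inv_mul_cancel₀ ht0]
      · rw [if_neg h1, if_neg h2, if_neg fun h => h2 h.symm, if_neg fun h => h1 h.symm, one_mul]

theorem edgeGain_eq_one {u v : V} (h : (u ≠ a ∧ v ≠ a) ∨ (u ≠ b ∧ v ≠ b)) :
    edgeGain a b t u v = 1 := by
  unfold edgeGain
  rw [if_neg, if_neg] <;> rintro ⟨rfl, rfl⟩ <;> simp at h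

theorem tri_edgeGain_eq_one {u v w : V}
    (h : (u ≠ a ∧ v ≠ a ∧ w ≠ a) ∨ (u ≠ b ∧ v ≠ b ∧ w ≠ b)) :
    tri (edgeGain a b t) u v w = 1 := by
  rw [tri, edgeGain_eq_one (by tauto), edgeGain_eq_one (by tauto), edgeGain_eq_one (by tauto)]
  norm_num

theorem tri_edgeGain (hab : a ≠ b) {w : V} (hwa : w ≠ a) (hwb : w ≠ b) :
    tri (edgeGain a b t) a b w = t := by
  simp [tri, edgeGain, hab, hab.symm, hwa, hwb]

/-- A triangle that contains `a` and `b` arises from `a b w` by rotation and reversal. -/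
theorem tri_induction {P : V → V → V → Prop} (hrot : ∀ u v w, P u v w → P v w u)
    (hswap : ∀ u v w, P u v w → P u w v) (hab : a ≠ b) (hP : ∀ w, P a b w) {u v w : V}
    (ha : a ∈ ({u, v, w} : Finset V)) (hb : b ∈ ({u, v, w} : Finset V)) : P u v w := by
  simp only [Finset.mem_insert, Finset.mem_singleton] at ha hb
  rcases ha with rfl | rfl | rfl <;> rcases hb with rfl | rfl | rfl
  · exact absurd rfl hab
  · exact hP _
  · exact hswap _ _ _ (hP _)
  · exact hrot _ _ _ (hrot _ _ _ (hswap _ _ _ (hP _)))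
  · exact absurd rfl hab
  · exact hrot _ _ _ (hrot _ _ _ (hP _))
  · exact hrot _ _ _ (hP _)
  · exact hrot _ _ _ (hswap _ _ _ (hP _))
  · exact absurd rfl hab

theorem mem_of_tri_edgeGain_ne {u v w : V} (h : tri (edgeGain a b t) u v w ≠ 1) :
    a ∈ ({u, v, w} : Finset V) ∧ b ∈ ({u, v, w} : Finset V) := by
  simp only [Finset.mem_insert, Finset.mem_singleton]
  by_contra hn
  refine h (tri_edgeGain_eq_one ?_)
  rw [not_and_or] at hn
  simp only [not_or] at hn
  exact hn.imp (fun h => ⟨Ne.symm h.1, Ne.symm h.2.1, Ne.symm h.2.2⟩)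
    (fun h => ⟨Ne.symm h.1, Ne.symm h.2.1, Ne.symm h.2.2⟩)

theorem tri_edgeGain_ne (hab : a ≠ b) (ht : t = omega ∨ t = 1 - omega) {u v w : V} (huv : u ≠ v)
    (huw : u ≠ w) (hvw : v ≠ w) (ha : a ∈ ({u, v, w} : Finset V))
    (hb : b ∈ ({u, v, w} : Finset V)) : tri (edgeGain a b t) u v w ≠ 1 := by
  have hg := isGain_edgeGain hab (mem_gainSet_of_cases ht)
  refine tri_induction (a := a) (b := b)
    (P := fun u v w => u ≠ v → u ≠ w → v ≠ w → tri (edgeGain a b t) u v w ≠ 1)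
    (fun u v w h h1 h2 h3 => by rw [← tri_rotate]; exact h h2.symm h3.symm h1)
    (fun u v w h h1 h2 h3 h4 => h h2 h1 h3.symm (hg.tri_swap_eq_one h4)) hab
    (fun w _ h2 h3 => ?_) ha hb huv huw hvw
  rw [tri_edgeGain hab h2.symm h3.symm]
  exact ne_one_of_cases ht

/-- Puts the second alternative of `balanced_or_star` into one formula: up to rotation and reversal,
a triangle contains both `a` and `b` as `a b w`, or misses one of them. -/
theorem IsGain.tri_eq_edgeGain {g : V → V → ℂ} (hg : IsGain g) (hab : a ≠ b) (ht : t ∈ gainSet)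
    {S : Set V} (h1 : ∀ w ∈ S, w ≠ a → w ≠ b → tri g a b w = t)
    (h2 : ∀ u ∈ S, ∀ v ∈ S, ∀ w ∈ S, (u ≠ a ∧ v ≠ a ∧ w ≠ a) ∨ (u ≠ b ∧ v ≠ b ∧ w ≠ b) →
      tri g u v w = 1) {u v w : V} (hu : u ∈ S) (hv : v ∈ S) (hw : w ∈ S) :
    tri g u v w = tri (edgeGain a b t) u v w := by
  have he := isGain_edgeGain hab ht
  by_cases hmem : a ∈ ({u, v, w} : Finset V) ∧ b ∈ ({u, v, w} : Finset V)
  · refine tri_induction (a := a) (b := b)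
      (P := fun u v w => u ∈ S → v ∈ S → w ∈ S →
        tri g u v w = tri (edgeGain a b t) u v w)
      (fun u v w h hv hw hu => by rw [← tri_rotate, ← tri_rotate (g := edgeGain a b t), h hu hv hw])
      (fun u v w h hu hw hv => by rw [← hg.star_tri, ← he.star_tri, h hu hv hw]) hab
      (fun w _ _ hw => ?_) hmem.1 hmem.2 hu hv hw
    by_cases hwa : w = a
    · subst hwa; rw [hg.tri_outer, he.tri_outer]
    by_cases hwb : w = b
    · subst hwb; rw [hg.tri_right, he.tri_right]
    rw [h1 w hw hwa hwb, tri_edgeGain hab hwa hwb]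
  · simp only [Finset.mem_insert, Finset.mem_singleton, not_and_or, not_or] at hmem
    have hor : (u ≠ a ∧ v ≠ a ∧ w ≠ a) ∨ (u ≠ b ∧ v ≠ b ∧ w ≠ b) :=
      hmem.imp (fun h => ⟨Ne.symm h.1, Ne.symm h.2.1, Ne.symm h.2.2⟩)
        (fun h => ⟨Ne.symm h.1, Ne.symm h.2.1, Ne.symm h.2.2⟩)
    rw [h2 u hu v hv w hw hor, tri_edgeGain_eq_one hor]

end EdgeGain

/-! ### Local structure around each clique. -/

/-- The vertex `u` lies in `C_i` or in `C_{i+1}`. -/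
def InPair {V : Type*} (c : V → Fin 5) (i : Fin 5) (u : V) : Prop := c u = i ∨ c u = i + 1

/-- The 5-tuple `f` picks one vertex from each clique. -/
def Transversal {V : Type*} (c : V → Fin 5) (f : Fin 5 → V) : Prop := ∀ i, c (f i) = i

/-- The gain of the 5-cycle through the vertices of a transversal. -/
noncomputable def cyc {V : Type*} (g : V → V → ℂ) (f : Fin 5 → V) : ℂ :=
  ∏ i, g (f i) (f (i + 1))

/-- The triangles in the three cliques around `C_j`, and the 5-cycles that agree with `f` in the
two remaining cliques, have the gains that arise from the gain `t` on the single arc `ab`. -/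
structure Star {V : Type*} [DecidableEq V] (g : V → V → ℂ) (c : V → Fin 5) (j : Fin 5)
    (f : Fin 5 → V) (a b : V) (t : ℂ) : Prop where
  ne : a ≠ b
  gain : t = omega ∨ t = 1 - omega
  left_mem : c a = j + 4 ∨ c a = j ∨ c a = j + 1
  right_mem : c b = j + 4 ∨ c b = j ∨ c b = j + 1
  tri_eq : ∀ i, i = j ∨ i + 1 = j → ∀ u v w, InPair c i u → InPair c i v → InPair c i w →
    tri g u v w = tri (edgeGain a b t) u v w
  cyc_eq : ∀ f', Transversal c f' → f' (j + 2) = f (j + 2) → f' (j + 3) = f (j + 3) →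
    cyc g f' = -tri (edgeGain a b t) (f' (j + 4)) (f' j) (f' (j + 1))

/-- The local structure around each clique: balanced, or balanced up to one edge. -/
def LocalStar {V : Type*} [DecidableEq V] (g : V → V → ℂ) (c : V → Fin 5) : Prop :=
  ∀ j f, Transversal c f →
    ((∀ i, i = j ∨ i + 1 = j → ∀ u v w, InPair c i u → InPair c i v → InPair c i w →
        tri g u v w = 1) ∧
      ∀ f', Transversal c f' → f' (j + 2) = f (j + 2) → f' (j + 3) = f (j + 3) →
        cyc g f' = -1) ∨
    ∃ a b t, Star g c j f a b t

theorem tri_contract_transversal {V : Type*} (g : V → V → ℂ) {c : V → Fin 5} {f : Fin 5 → V}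
    (hf : Transversal c f) (j : Fin 5) :
    tri (contract g c j (f (j + 2)) (f (j + 3))) (f (j + 4)) (f j) (f (j + 1)) = -cyc g f := by
  have h1 : ∀ j : Fin 5, j + 1 ≠ j + 4 ∧ j ≠ j + 1 ∧ j ≠ j + 4 := by decide
  obtain ⟨h1, h2, h3⟩ := h1 j
  simp only [tri, contract, hf _, h1, h1.symm, h2, h3, and_true, and_false,
    and_self, if_true, if_false]
  fin_cases j <;> simp [cyc, Fin.prod_univ_five] <;> ring

theorem contract_of_inPair {V : Type*} (g : V → V → ℂ) {c : V → Fin 5} {j : Fin 5} (x y : V)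
    {i : Fin 5} (hi : i = j ∨ i + 1 = j) {u v : V} (hu : InPair c i u) (hv : InPair c i v) :
    contract g c j x y u v = g u v := by
  have key : ∀ i j p q : Fin 5, (i = j ∨ i + 1 = j) → (p = i ∨ p = i + 1) →
      (q = i ∨ q = i + 1) → ¬(p = j + 4 ∧ q = j + 1) := by decide
  rw [contract, if_neg (key i j _ _ hi hu hv), if_neg fun h => key i j _ _ hi hv hu h.symm]

/-- This is `balanced_or_star` for the contracted window: contraction keeps the gains within two
consecutive cliques, and a triangle through all three is minus a 5-cycle through the eliminated
vertices. -/
theorem Signature.SecondPosThirdNeg.localStar {V : Type*} [Fintype V] [DecidableEq V]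
    {G : SimpleGraph V} [DecidableRel G.Adj] {φ : Signature G} (hφ : φ.SecondPosThirdNeg)
    {c : V → Fin 5} (hc : IsExpansion G c) : LocalStar φ.fullGain c := by
  intro j f hf
  have hL := hφ.lorentzian_contract hc (hf (j + 2)) (hf (j + 3))
  set g := φ.fullGain
  have hg' := isGain_contract φ.isGain_fullGain c j (f (j + 2)) (f (j + 3))
  have hgW : IsGain fun u v : Window c j => contract g c j (f (j + 2)) (f (j + 3)) u v :=
    ⟨fun u => hg'.diag u, fun u v => hg'.mem u v, fun u v => hg'.inv u v⟩
  have hpair : ∀ i, i = j ∨ i + 1 = j → ∀ u, InPair c i u →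
      c u = j + 4 ∨ c u = j ∨ c u = j + 1 := by
    intro i hi u hu
    have key : ∀ i j p : Fin 5, (i = j ∨ i + 1 = j) → (p = i ∨ p = i + 1) →
      p = j + 4 ∨ p = j ∨ p = j + 1 := by decide
    exact key i j _ hi hu
  have htri : ∀ i, i = j ∨ i + 1 = j → ∀ u v w, InPair c i u → InPair c i v → InPair c i w →
      tri g u v w = tri (contract g c j (f (j + 2)) (f (j + 3))) u v w := by
    intro i hi u v w hu hv hw
    rw [tri, tri, contract_of_inPair g _ _ hi hu hv, contract_of_inPair g _ _ hi hv hw,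
      contract_of_inPair g _ _ hi hw hu]
  have hcyc : ∀ f', Transversal c f' → f' (j + 2) = f (j + 2) → f' (j + 3) = f (j + 3) →
      cyc g f' = -tri (contract g c j (f (j + 2)) (f (j + 3))) (f' (j + 4)) (f' j)
        (f' (j + 1)) := by
    intro f' hf' h2 h3
    rw [← h2, ← h3, tri_contract_transversal g hf', neg_neg]
  rcases hL.balanced_or_star hgW with h | ⟨⟨a, ha⟩, ⟨b, hb⟩, t, hab, ht, h1, h2⟩
  · left
    constructor
    · intro i hi u v w hu hv hw
      rw [htri i hi u v w hu hv hw]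
      exact h ⟨u, hpair i hi u hu⟩ ⟨v, hpair i hi v hv⟩ ⟨w, hpair i hi w hw⟩
    · intro f' hf' e2 e3
      rw [hcyc f' hf' e2 e3]
      exact congrArg Neg.neg (h ⟨f' (j + 4), Or.inl (hf' _)⟩ ⟨f' j, Or.inr (Or.inl (hf' _))⟩
        ⟨f' (j + 1), Or.inr (Or.inr (hf' _))⟩)
  · right
    have hab' : a ≠ b := fun h => hab (Subtype.ext h)
    have hall : ∀ u v w, (c u = j + 4 ∨ c u = j ∨ c u = j + 1) →
        (c v = j + 4 ∨ c v = j ∨ c v = j + 1) → (c w = j + 4 ∨ c w = j ∨ c w = j + 1) →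
        tri (contract g c j (f (j + 2)) (f (j + 3))) u v w = tri (edgeGain a b t) u v w := by
      intro u v w hu hv hw
      refine hg'.tri_eq_edgeGain hab' (mem_gainSet_of_cases ht)
        (S := {v | c v = j + 4 ∨ c v = j ∨ c v = j + 1}) ?_ ?_ hu hv hw
      · intro w hw hwa hwb
        exact h1 ⟨w, hw⟩ (fun h => hwa (congrArg Subtype.val h))
          (fun h => hwb (congrArg Subtype.val h))
      · intro u hu v hv w hw h
        refine h2 ⟨u, hu⟩ ⟨v, hv⟩ ⟨w, hw⟩ ?_
        simpa [Subtype.ext_iff] using h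
    refine ⟨a, b, t, hab', ht, ha, hb, ?_, ?_⟩
    · intro i hi u v w hu hv hw
      rw [htri i hi u v w hu hv hw]
      exact hall u v w (hpair i hi u hu) (hpair i hi v hv) (hpair i hi w hw)
    · intro f' hf' e2 e3
      rw [hcyc f' hf' e2 e3, hall _ _ _ (Or.inl (hf' _)) (Or.inr (Or.inl (hf' _)))
        (Or.inr (Or.inr (hf' _)))]


/-! ### Comparison of the exceptional arcs of different windows. -/

section Combinatorics

variable {V : Type*} {g : V → V → ℂ} {c : V → Fin 5}

theorem InPair.of_left {i : Fin 5} {u : V} (h : c u = i) : InPair c i u := Or.inl h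

theorem InPair.of_right {i : Fin 5} {u : V} (h : c u = i + 1) : InPair c i u := Or.inr h

theorem Transversal.ne {f : Fin 5 → V} (hf : Transversal c f) {i j : Fin 5} (hij : i ≠ j) :
    f i ≠ f j := fun h => hij (by rw [← hf i, ← hf j, h])

theorem Transversal.update {f : Fin 5 → V} (hf : Transversal c f) (a : V) :
    Transversal c (Function.update f (c a) a) := by
  intro i
  by_cases h : i = c a
  · subst h; simp
  · rw [Function.update_of_ne h, hf]

variable [DecidableEq V]

theorem InPair.of_mem {i : Fin 5} {u v w a : V} (hu : InPair c i u) (hv : InPair c i v)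
    (hw : InPair c i w) (ha : a ∈ ({u, v, w} : Finset V)) : InPair c i a := by
  simp only [Finset.mem_insert, Finset.mem_singleton] at ha
  rcases ha with rfl | rfl | rfl <;> assumption

theorem not_four_mem {a b a' b' u v w : V} (ha : a ∈ ({u, v, w} : Finset V))
    (hb : b ∈ ({u, v, w} : Finset V)) (ha' : a' ∈ ({u, v, w} : Finset V))
    (hb' : b' ∈ ({u, v, w} : Finset V)) (h1 : a ≠ b) (h2 : a ≠ a') (h3 : a ≠ b') (h4 : b ≠ a')
    (h5 : b ≠ b') (h6 : a' ≠ b') : False := by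
  have hsub : ({a, b, a', b'} : Finset V) ⊆ {u, v, w} := by
    intro x hx
    rw [Finset.mem_insert, Finset.mem_insert, Finset.mem_insert, Finset.mem_singleton] at hx
    rcases hx with rfl | rfl | rfl | rfl <;> assumption
  have h := Finset.card_le_card hsub
  have h3 : ({u, v, w} : Finset V).card ≤ 3 := Finset.card_le_three
  have h4 : ({a, b, a', b'} : Finset V).card = 4 := by
    rw [Finset.card_insert_of_notMem, Finset.card_insert_of_notMem, Finset.card_pair h6] <;>
      simp [*]
  omega

/-- A nontrivial triangle has three distinct vertices. The third one later pins down `t`, and can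
replace `a` or `b` in a 5-cycle. -/
theorem IsGain.exists_third (hg : IsGain g) {u v w : V} (h : tri g u v w ≠ 1) (a b : V) :
    ∃ x ∈ ({u, v, w} : Finset V), x ≠ a ∧ x ≠ b := by
  have huv : u ≠ v := by rintro rfl; exact h (hg.tri_left _ _)
  have huw : u ≠ w := by rintro rfl; exact h (hg.tri_outer _ _)
  have hvw : v ≠ w := by rintro rfl; exact h (hg.tri_right _ _)
  have hc : ({a, b} : Finset V).card < ({u, v, w} : Finset V).card := by
    rw [Finset.card_eq_three.2 ⟨u, v, w, huv, huw, hvw, rfl⟩]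
    exact lt_of_le_of_lt Finset.card_le_two (by norm_num)
  obtain ⟨x, hx, hn⟩ := Finset.exists_mem_notMem_of_card_lt_card hc
  exact ⟨x, hx, by simpa using hn⟩

namespace Star

variable {j : Fin 5} {f : Fin 5 → V} {a b : V} {t : ℂ}

theorem swap (h : Star g c j f a b t) : Star g c j f b a t⁻¹ where
  ne := h.ne.symm
  gain := inv_cases h.gain
  left_mem := h.right_mem
  right_mem := h.left_mem
  tri_eq := by rw [edgeGain_swap h.ne]; exact h.tri_eq
  cyc_eq := by rw [edgeGain_swap h.ne]; exact h.cyc_eq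

theorem mem_of_tri_ne (h : Star g c j f a b t) {i : Fin 5} (hi : i = j ∨ i + 1 = j) {u v w : V}
    (hu : InPair c i u) (hv : InPair c i v) (hw : InPair c i w) (hne : tri g u v w ≠ 1) :
    a ∈ ({u, v, w} : Finset V) ∧ b ∈ ({u, v, w} : Finset V) := by
  rw [h.tri_eq i hi u v w hu hv hw] at hne
  exact mem_of_tri_edgeGain_ne hne

theorem tri_eq_gain (h : Star g c j f a b t) {i : Fin 5} (hi : i = j ∨ i + 1 = j) {w : V}
    (ha : InPair c i a) (hb : InPair c i b) (hw : InPair c i w) (hwa : w ≠ a) (hwb : w ≠ b) :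
    tri g a b w = t := by
  rw [h.tri_eq i hi a b w ha hb hw, tri_edgeGain h.ne hwa hwb]

theorem tri_ne (h : Star g c j f a b t) {i : Fin 5} (hi : i = j ∨ i + 1 = j) {w : V}
    (ha : InPair c i a) (hb : InPair c i b) (hw : InPair c i w) (hwa : w ≠ a) (hwb : w ≠ b) :
    tri g a b w ≠ 1 := by
  rw [h.tri_eq_gain hi ha hb hw hwa hwb]
  exact ne_one_of_cases h.gain

/-- The exceptional 5-cycles with the prescribed far vertices are those through both `a` and `b`. -/
theorem cyc_ne_iff (h : Star g c j f a b t) {f' : Fin 5 → V} (hf' : Transversal c f')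
    (h2 : f' (j + 2) = f (j + 2)) (h3 : f' (j + 3) = f (j + 3)) :
    cyc g f' ≠ -1 ↔ f' (c a) = a ∧ f' (c b) = b := by
  have hmem : ∀ x, (c x = j + 4 ∨ c x = j ∨ c x = j + 1) →
      (x ∈ ({f' (j + 4), f' j, f' (j + 1)} : Finset V) ↔ f' (c x) = x) := by
    intro x hx
    simp only [Finset.mem_insert, Finset.mem_singleton]
    constructor
    · rintro (h | h | h) <;> rw [h, hf']
    · intro h
      rcases hx with hx | hx | hx <;> rw [hx] at h <;> simp [h]
  rw [← hmem a h.left_mem, ← hmem b h.right_mem, h.cyc_eq f' hf' h2 h3, Ne, neg_inj]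
  refine ⟨mem_of_tri_edgeGain_ne, fun hm => ?_⟩
  have key : ∀ j : Fin 5, j + 4 ≠ j ∧ j + 4 ≠ j + 1 ∧ j ≠ j + 1 := by decide
  exact tri_edgeGain_ne h.ne h.gain (hf'.ne (key j).1) (hf'.ne (key j).2.1)
    (hf'.ne (key j).2.2) hm.1 hm.2

end Star

namespace LocalStar

variable (h : LocalStar g c)
include h

theorem star_of_tri_ne {i j : Fin 5} (hi : i = j ∨ i + 1 = j) {u v w : V}
    (hu : InPair c i u) (hv : InPair c i v) (hw : InPair c i w) (hne : tri g u v w ≠ 1)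
    {f : Fin 5 → V} (hf : Transversal c f) : ∃ a b t, Star g c j f a b t :=
  (h j f hf).resolve_left fun hb => hne (hb.1 i hi u v w hu hv hw)

theorem star_of_cyc_ne (j : Fin 5) {f : Fin 5 → V} (hf : Transversal c f) (hne : cyc g f ≠ -1) :
    ∃ a b t, Star g c j f a b t :=
  (h j f hf).resolve_left fun hb => hne (hb.2 f hf rfl rfl)

/-- When two overlapping pairs of cliques are unbalanced, the exceptional arc at the shared clique
lies in both pairs, hence inside that clique. No transversal contains both of its ends. -/
theorem cyc_eq_of_tri_ne {i j : Fin 5} (hij : i + 1 = j) {u v w u' v' w' : V}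
    (hu : InPair c i u) (hv : InPair c i v) (hw : InPair c i w) (hne : tri g u v w ≠ 1)
    (hu' : InPair c j u') (hv' : InPair c j v') (hw' : InPair c j w') (hne' : tri g u' v' w' ≠ 1)
    {f : Fin 5 → V} (hf : Transversal c f) : cyc g f = -1 := by
  obtain ⟨a, b, t, hS⟩ := h.star_of_tri_ne (Or.inr hij) hu hv hw hne hf
  by_contra hcyc
  have key : ∀ i j p : Fin 5, i + 1 = j → (p = i ∨ p = i + 1) → (p = j ∨ p = j + 1) → p = j := by
    decide
  obtain ⟨ha, hb⟩ := hS.mem_of_tri_ne (Or.inr hij) hu hv hw hne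
  obtain ⟨ha', hb'⟩ := hS.mem_of_tri_ne (Or.inl rfl) hu' hv' hw' hne'
  have ca := key i j _ hij (hu.of_mem hv hw ha) (hu'.of_mem hv' hw' ha')
  have cb := key i j _ hij (hu.of_mem hv hw hb) (hu'.of_mem hv' hw' hb')
  obtain ⟨fa, fb⟩ := (hS.cyc_ne_iff hf rfl rfl).1 hcyc
  rw [ca] at fa
  rw [cb] at fb
  exact hS.ne (fa.symm.trans fb)

/-- Both 5-cycles would contain the two ends of the exceptional arc at `C_j`, but inside the window
they share at most the vertex in `C_j`. -/
theorem false_of_agree (j : Fin 5) {f f' : Fin 5 → V} (hf : Transversal c f)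
    (hf' : Transversal c f') (hne : cyc g f ≠ -1) (hne' : cyc g f' ≠ -1)
    (h2 : f' (j + 2) = f (j + 2)) (h3 : f' (j + 3) = f (j + 3)) (h4 : f' (j + 4) ≠ f (j + 4))
    (h1 : f' (j + 1) ≠ f (j + 1)) : False := by
  obtain ⟨a, b, t, hS⟩ := h.star_of_cyc_ne j hf hne
  obtain ⟨ha, hb⟩ := (hS.cyc_ne_iff hf rfl rfl).1 hne
  obtain ⟨ha', hb'⟩ := (hS.cyc_ne_iff hf' h2 h3).1 hne'
  have key : ∀ x, (c x = j + 4 ∨ c x = j ∨ c x = j + 1) → f (c x) = x → f' (c x) = x →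
      x = f j := by
    intro x hx e e'
    rcases hx with hx | hx | hx
    · rw [hx] at e e'; exact absurd (e'.trans e.symm) h4
    · rw [hx] at e; exact e.symm
    · rw [hx] at e e'; exact absurd (e'.trans e.symm) h1
  exact hS.ne ((key a hS.left_mem ha ha').trans (key b hS.right_mem hb hb').symm)

end LocalStar

/-! ### All 5-cycles have gain `-1` -/

theorem Star.same_clique {j : Fin 5} {f : Fin 5 → V} {a b : V} {t : ℂ}
    (hS : Star g c j f a b t) (hf : Transversal c f)
    (hall : ∀ f, Transversal c f → cyc g f = -1) : c a = c b := by
  by_contra hab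
  have hf' := (hf.update b).update a
  have key : ∀ j p : Fin 5, (p = j + 4 ∨ p = j ∨ p = j + 1) → j + 2 ≠ p ∧ j + 3 ≠ p := by decide
  have ka := key j _ hS.left_mem
  have kb := key j _ hS.right_mem
  refine (hS.cyc_ne_iff hf' ?_ ?_).2 ⟨?_, ?_⟩ (hall _ hf')
  · rw [Function.update_of_ne ka.1, Function.update_of_ne kb.1]
  · rw [Function.update_of_ne ka.2, Function.update_of_ne kb.2]
  · simp
  · rw [Function.update_of_ne (Ne.symm hab)]; simp

/-- The windows centred at `C_i` and `C_{i+1}` each give an arc inside one clique. If neither arc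
lay in its own centre, the nontrivial triangle would contain four distinct vertices. -/
theorem LocalStar.exists_center (h : LocalStar g c) {f : Fin 5 → V} (hf : Transversal c f)
    (hall : ∀ f, Transversal c f → cyc g f = -1) {i : Fin 5} {u v w : V} (hu : InPair c i u)
    (hv : InPair c i v) (hw : InPair c i w) (hne : tri g u v w ≠ 1) :
    ∃ j, (j = i ∨ j = i + 1) ∧ ∃ a b t, Star g c j f a b t ∧ c a = j ∧ c b = j := by
  obtain ⟨a, b, t, hS⟩ := h.star_of_tri_ne (Or.inl rfl) hu hv hw hne hf
  obtain ⟨a', b', t', hS'⟩ := h.star_of_tri_ne (Or.inr rfl) hu hv hw hne hf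
  obtain ⟨ha, hb⟩ := hS.mem_of_tri_ne (Or.inl rfl) hu hv hw hne
  obtain ⟨ha', hb'⟩ := hS'.mem_of_tri_ne (Or.inr rfl) hu hv hw hne
  have hab := hS.same_clique hf hall
  have hab' := hS'.same_clique hf hall
  have key : ∀ i : Fin 5, i ≠ i + 1 := by decide
  rcases hu.of_mem hv hw ha with ca | ca
  · exact ⟨i, Or.inl rfl, a, b, t, hS, ca, hab ▸ ca⟩
  rcases hu.of_mem hv hw ha' with ca' | ca'
  · have hne : ∀ x y, c x = i + 1 → c y = i → x ≠ y := fun x y hx hy hxy =>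
      key i (by rw [← hx, ← hy, hxy])
    exact (not_four_mem ha hb ha' hb' hS.ne (hne _ _ ca ca') (hne _ _ ca (hab' ▸ ca'))
      (hne _ _ (hab ▸ ca) ca') (hne _ _ (hab ▸ ca) (hab' ▸ ca')) hS'.ne).elim
  · exact ⟨i + 1, Or.inr rfl, a', b', t', hS', ca', hab' ▸ ca'⟩

theorem LocalStar.tri_eq_of_center (h : LocalStar g c) {f : Fin 5 → V}
    (hf : Transversal c f) (hall : ∀ f, Transversal c f → cyc g f = -1) {j : Fin 5} {a b : V}
    {t : ℂ} (hS : Star g c j f a b t) (ha : c a = j) (hb : c b = j) (i : Fin 5) (u v w : V)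
    (hu : InPair c i u) (hv : InPair c i v) (hw : InPair c i w) :
    tri g u v w = tri (edgeGain a b t) u v w := by
  have hne : ∀ {x y}, c x ≠ c y → x ≠ y := fun hxy e => hxy (congrArg c e)
  have k4 : ∀ j : Fin 5, j + 4 + 1 = j := by decide
  have k41 : ∀ j : Fin 5, j + 4 ≠ j ∧ j + 1 ≠ j := by decide
  have hr : ∀ x, c x = j → f (j + 1) ≠ x := fun x hx => hne (by rw [hf, hx]; exact (k41 j).2)
  have hl : ∀ x, c x = j → f (j + 4) ≠ x := fun x hx => hne (by rw [hf, hx]; exact (k41 j).1)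
  -- The exceptional arc at `C_{j+1}` would lie in `uvw` and in the nontrivial triangle `a, b, f (j
  -- + 1)`, which share at most one vertex.
  have bal1 : ∀ u v w, InPair c (j + 1) u → InPair c (j + 1) v → InPair c (j + 1) w →
      tri g u v w = 1 := by
    intro u v w hu hv hw
    by_contra hT
    obtain ⟨a', b', t', hS'⟩ := h.star_of_tri_ne (Or.inl rfl) hu hv hw hT hf
    have hT0 := hS.tri_ne (Or.inl rfl) (.of_left ha) (.of_left hb) (.of_right (hf (j + 1)))
      (hr a ha) (hr b hb)
    obtain ⟨m1, m2⟩ := hS'.mem_of_tri_ne (Or.inl rfl) hu hv hw hT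
    obtain ⟨n1, n2⟩ := hS'.mem_of_tri_ne (Or.inr rfl) (.of_left ha) (.of_left hb)
      (.of_right (hf (j + 1))) hT0
    have key : ∀ x, x ∈ ({a, b, f (j + 1)} : Finset V) → InPair c (j + 1) x → x = f (j + 1) := by
      intro x hx hp
      simp only [Finset.mem_insert, Finset.mem_singleton] at hx
      have k : ∀ j : Fin 5, ¬(j = j + 1 ∨ j = j + 1 + 1) := by decide
      rcases hx with rfl | rfl | hx
      · rw [InPair, ha] at hp; exact (k j hp).elim
      · rw [InPair, hb] at hp; exact (k j hp).elim
      · exact hx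
    exact hS'.ne ((key _ n1 (hu.of_mem hv hw m1)).trans (key _ n2 (hu.of_mem hv hw m2)).symm)
  have k34 : ∀ j : Fin 5, j + 3 + 1 = j + 4 := by decide
  have bal3 : ∀ u v w, InPair c (j + 3) u → InPair c (j + 3) v → InPair c (j + 3) w →
      tri g u v w = 1 := by
    intro u v w hu hv hw
    by_contra hT
    obtain ⟨a', b', t', hS'⟩ := h.star_of_tri_ne (Or.inr (k34 j)) hu hv hw hT hf
    have pa : InPair c (j + 4) a := .of_right (by rw [ha, k4])
    have pb : InPair c (j + 4) b := .of_right (by rw [hb, k4])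
    have hT0 := hS.tri_ne (Or.inr (k4 j)) pa pb (.of_left (hf (j + 4))) (hl a ha) (hl b hb)
    obtain ⟨m1, m2⟩ := hS'.mem_of_tri_ne (Or.inr (k34 j)) hu hv hw hT
    obtain ⟨n1, n2⟩ := hS'.mem_of_tri_ne (Or.inl rfl) pa pb (.of_left (hf (j + 4))) hT0
    have key : ∀ x, x ∈ ({a, b, f (j + 4)} : Finset V) → InPair c (j + 3) x → x = f (j + 4) := by
      intro x hx hp
      simp only [Finset.mem_insert, Finset.mem_singleton] at hx
      have k : ∀ j : Fin 5, ¬(j = j + 3 ∨ j = j + 3 + 1) := by decide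
      rcases hx with rfl | rfl | hx
      · rw [InPair, ha] at hp; exact (k j hp).elim
      · rw [InPair, hb] at hp; exact (k j hp).elim
      · exact hx
    exact hS'.ne ((key _ n1 (hu.of_mem hv hw m1)).trans (key _ n2 (hu.of_mem hv hw m2)).symm)
  -- An exceptional arc inside `C_{j+2}` or `C_{j+3}` would also unbalance the neighbouring pair
  -- treated in `bal1` or `bal3`.
  have bal2 : ∀ u v w, InPair c (j + 2) u → InPair c (j + 2) v → InPair c (j + 2) w →
      tri g u v w = 1 := by
    intro u v w hu hv hw
    by_contra hT
    obtain ⟨j', hj', a', b', t', hS', ca', cb'⟩ := h.exists_center hf hall hu hv hw hT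
    rcases hj' with rfl | rfl
    · have k : ∀ j : Fin 5, j + 1 + 1 = j + 2 ∧ j + 1 ≠ j + 2 := by decide
      have pa : InPair c (j + 1) a' := .of_right (by rw [ca', (k j).1])
      have pb : InPair c (j + 1) b' := .of_right (by rw [cb', (k j).1])
      exact hS'.tri_ne (Or.inr (k j).1) pa pb (.of_left (hf (j + 1)))
        (hne (by rw [hf, ca']; exact (k j).2)) (hne (by rw [hf, cb']; exact (k j).2))
        (bal1 _ _ _ pa pb (.of_left (hf (j + 1))))
    · have k : ∀ j : Fin 5, j + 2 + 1 = j + 3 ∧ j + 4 ≠ j + 2 + 1 := by decide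
      have pa : InPair c (j + 3) a' := .of_left (by rw [ca', (k j).1])
      have pb : InPair c (j + 3) b' := .of_left (by rw [cb', (k j).1])
      have pw : InPair c (j + 3) (f (j + 4)) := .of_right (by rw [hf, k34])
      exact hS'.tri_ne (Or.inl (k j).1.symm) pa pb pw
        (hne (by rw [hf, ca']; exact (k j).2)) (hne (by rw [hf, cb']; exact (k j).2))
        (bal3 _ _ _ pa pb pw)
  by_cases hi : i = j ∨ i + 1 = j
  · exact hS.tri_eq i hi u v w hu hv hw
  have hE : tri (edgeGain a b t) u v w = 1 := by
    have key : ∀ i j p : Fin 5, ¬(i = j ∨ i + 1 = j) → (p = i ∨ p = i + 1) → p ≠ j := by decide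
    refine tri_edgeGain_eq_one (Or.inl ⟨?_, ?_, ?_⟩) <;> refine hne ?_ <;> rw [ha]
    · exact key i j _ hi hu
    · exact key i j _ hi hv
    · exact key i j _ hi hw
  rw [hE]
  have key : ∀ i j : Fin 5, ¬(i = j ∨ i + 1 = j) → i = j + 1 ∨ i = j + 2 ∨ i = j + 3 := by decide
  rcases key i j hi with rfl | rfl | rfl
  · exact bal1 u v w hu hv hw
  · exact bal2 u v w hu hv hw
  · exact bal3 u v w hu hv hw

end Combinatorics


/-! ### An exceptional arc between two consecutive cliques. -/

section Crossing

variable {V : Type*} {g : V → V → ℂ} {c : V → Fin 5}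

theorem transversal_vec {v₀ v₁ v₂ v₃ v₄ : V} (h₀ : c v₀ = 0) (h₁ : c v₁ = 1) (h₂ : c v₂ = 2)
    (h₃ : c v₃ = 3) (h₄ : c v₄ = 4) : Transversal c ![v₀, v₁, v₂, v₃, v₄] := by
  intro i
  fin_cases i <;> assumption

theorem cyc_add (f : Fin 5 → V) (k : Fin 5) : cyc g (fun i => f (i + k)) = cyc g f := by
  unfold cyc
  rw [← Equiv.prod_comp (Equiv.addRight k) fun i => g (f i) (f (i + 1))]
  refine Finset.prod_congr rfl fun i _ => ?_
  simp only [Equiv.coe_addRight]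
  rw [add_right_comm]

theorem Transversal.shift {f : Fin 5 → V} (hf : Transversal c f) (k : Fin 5) :
    Transversal (fun v => c v - k) fun i => f (i + k) := by
  intro i
  change c (f (i + k)) - k = i
  rw [hf, add_sub_cancel_right]

theorem InPair.shift {i : Fin 5} {u : V} (hu : InPair c i u) (k : Fin 5) :
    InPair (fun v => c v - k) (i - k) u := by
  rcases hu with hu | hu
  · exact Or.inl (congrArg (· - k) hu)
  · exact Or.inr ((congrArg (· - k) hu).trans (add_sub_right_comm _ _ _))

variable [DecidableEq V]

/-- If `C_0 ∪ C_1` is unbalanced and some 5-cycle has a gain other than `-1`, then the exceptional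
edges for the centres `C_0` and `C_1` join `C_0` to `C_1`, and they coincide. -/
theorem LocalStar.exists_crossing (h : LocalStar g c) {u v w : V} (hu : InPair c 0 u)
    (hv : InPair c 0 v) (hw : InPair c 0 w) (hT : tri g u v w ≠ 1)
    (hbad : ∃ f, Transversal c f ∧ cyc g f ≠ -1) {f : Fin 5 → V} (hf : Transversal c f) :
    ∃ a b t, c a = 0 ∧ c b = 1 ∧ a ∈ ({u, v, w} : Finset V) ∧ b ∈ ({u, v, w} : Finset V) ∧
      Star g c 1 f a b t ∧ ∀ f', Transversal c f' → f' 2 = f 2 → f' 3 = f 3 →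
        (cyc g f' ≠ -1 ↔ f' 0 = a ∧ f' 1 = b) := by
  obtain ⟨f₀, hf₀, hcyc⟩ := hbad
  have hne : ∀ {x y}, c x ≠ c y → x ≠ y := fun hxy e => hxy (congrArg c e)
  obtain ⟨a, b, t, hS⟩ := h.star_of_tri_ne (j := 1) (Or.inr rfl) hu hv hw hT hf
  obtain ⟨a', b', t', hS'⟩ := h.star_of_tri_ne (j := 0) (Or.inl rfl) hu hv hw hT hf
  obtain ⟨ma, mb⟩ := hS.mem_of_tri_ne (Or.inr rfl) hu hv hw hT
  obtain ⟨ma', mb'⟩ := hS'.mem_of_tri_ne (Or.inl rfl) hu hv hw hT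
  have ca : c a = 0 ∨ c a = 1 := hu.of_mem hv hw ma
  have cb : c b = 0 ∨ c b = 1 := hu.of_mem hv hw mb
  have ca' : c a' = 0 ∨ c a' = 1 := hu.of_mem hv hw ma'
  have cb' : c b' = 0 ∨ c b' = 1 := hu.of_mem hv hw mb'
  have hS1 : ¬(c a = 1 ∧ c b = 1) := fun ⟨h1, h2⟩ =>
    hcyc (h.cyc_eq_of_tri_ne (i := 0) (j := 1) rfl hu hv hw hT (.of_left h1) (.of_left h2)
      (.of_right (hf 2)) (hS.tri_ne (i := 1) (Or.inl rfl) (.of_left h1) (.of_left h2)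
      (.of_right (hf 2)) (hne (by rw [hf, h1]; decide)) (hne (by rw [hf, h2]; decide))) hf₀)
  have hS0 : ¬(c a' = 0 ∧ c b' = 0) := fun ⟨h1, h2⟩ =>
    hcyc (h.cyc_eq_of_tri_ne (i := 4) (j := 0) rfl (.of_right h1) (.of_right h2)
      (.of_left (hf 4)) (hS'.tri_ne (i := 4) (Or.inr rfl) (.of_right h1) (.of_right h2)
      (.of_left (hf 4)) (hne (by rw [hf, h1]; decide)) (hne (by rw [hf, h2]; decide)))
      hu hv hw hT hf₀)
  have h1iff : ∀ f', Transversal c f' → f' 3 = f 3 → f' 4 = f 4 →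
      (cyc g f' ≠ -1 ↔ f' (c a) = a ∧ f' (c b) = b) := fun f' hf' h3 h4 =>
    hS.cyc_ne_iff hf' h3 h4
  have h0iff : ∀ f', Transversal c f' → f' 2 = f 2 → f' 3 = f 3 →
      (cyc g f' ≠ -1 ↔ f' (c a') = a' ∧ f' (c b') = b') := fun f' hf' h2 h3 =>
    hS'.cyc_ne_iff hf' h2 h3
  clear hcyc hf₀
  wlog hab : c a = 0 generalizing a b t
  · exact this b a t⁻¹ hS.swap mb ma cb ca (fun hh => hS1 hh.symm)
      (fun f' hf' h3 h4 => (h1iff f' hf' h3 h4).trans and_comm)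
      (cb.resolve_right fun hb => hS1 ⟨ca.resolve_left hab, hb⟩)
  -- With `f 2, f 3, f 4` fixed, both windows describe the same exceptional 5-cycles; varying only
  -- `z` and `y` compares the two arcs.
  have hiff : ∀ z y, c z = 0 → c y = 1 →
      ((![z, y, f 2, f 3, f 4] (c a) = a ∧ ![z, y, f 2, f 3, f 4] (c b) = b) ↔
        (![z, y, f 2, f 3, f 4] (c a') = a' ∧ ![z, y, f 2, f 3, f 4] (c b') = b')) := by
    intro z y hz hy
    have hF := transversal_vec hz hy (hf 2) (hf 3) (hf 4)
    exact (h1iff _ hF rfl rfl).symm.trans (h0iff _ hF rfl rfl)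
  rcases cb with cb | cb
  · exfalso
    rcases ca' with ca' | ca' <;> rcases cb' with cb' | cb'
    · exact hS0 ⟨ca', cb'⟩
    · have := hiff a' b' ca' cb'
      simp only [hab, cb, ca', cb'] at this
      obtain ⟨e1, e2⟩ := this.2 ⟨rfl, rfl⟩
      exact hS.ne (e1.symm.trans e2)
    · have := hiff b' a' cb' ca'
      simp only [hab, cb, ca', cb'] at this
      obtain ⟨e1, e2⟩ := this.2 ⟨rfl, rfl⟩
      exact hS.ne (e1.symm.trans e2)
    · have h01 : ∀ {x y}, c x = 0 → c y = 1 → x ≠ y := fun h1 h2 =>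
        hne (by rw [h1, h2]; decide)
      exact not_four_mem ma mb ma' mb' hS.ne (h01 hab ca') (h01 hab cb') (h01 cb ca')
        (h01 cb cb') hS'.ne
  · refine ⟨a, b, t, hab, cb, ma, mb, hS, fun f' hf' h2 h3 => ?_⟩
    rw [h0iff f' hf' h2 h3]
    have := hiff a b hab cb
    rcases ca' with ca' | ca' <;> rcases cb' with cb' | cb'
    · exact (hS0 ⟨ca', cb'⟩).elim
    · simp only [hab, cb, ca', cb'] at this ⊢
      obtain ⟨e1, e2⟩ := this.1 ⟨rfl, rfl⟩
      rw [← show a = a' from e1, ← show b = b' from e2]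
    · simp only [hab, cb, ca', cb'] at this ⊢
      obtain ⟨e1, e2⟩ := this.1 ⟨rfl, rfl⟩
      rw [← show b = a' from e1, ← show a = b' from e2, and_comm]
    · simp only [hab, cb, ca', cb'] at this
      obtain ⟨e1, e2⟩ := this.1 ⟨rfl, rfl⟩
      exact (hS'.ne (e1.symm.trans e2)).elim

/-- The arc from `exists_crossing` could depend on `f`. Comparing exceptional 5-cycles that differ
in few cliques shows that it does not, so one arc serves all 5-cycles. -/
theorem LocalStar.exists_crossing_edge (hg : IsGain g) (h : LocalStar g c) {u v w : V}
    (hu : InPair c 0 u) (hv : InPair c 0 v) (hw : InPair c 0 w) (hT : tri g u v w ≠ 1)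
    (hbad : ∃ f, Transversal c f ∧ cyc g f ≠ -1) :
    ∃ a b t, c a = 0 ∧ c b = 1 ∧ (t = omega ∨ t = 1 - omega) ∧
      (∃ x, InPair c 0 x ∧ x ≠ a ∧ x ≠ b) ∧
      (∀ i, i = 4 ∨ i = 0 ∨ i = 1 → ∀ u v w, InPair c i u → InPair c i v → InPair c i w →
        tri g u v w = tri (edgeGain a b t) u v w) ∧
      ∀ f, Transversal c f → cyc g f = -edgeGain a b t (f 0) (f 1) := by
  have hX := fun f hf => h.exists_crossing hu hv hw hT hbad (f := f) hf
  obtain ⟨f₀, hf₀, hcyc⟩ := id hbad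
  have hne : ∀ {x y}, c x ≠ c y → x ≠ y := fun hxy e => hxy (congrArg c e)
  obtain ⟨a, b, t, ca, cb, ma, mb, hS, hiff⟩ := hX f₀ hf₀
  obtain ⟨x, hx, hxa, hxb⟩ := hg.exists_third hT a b
  have hpx := hu.of_mem hv hw hx
  have hstar : ∀ f, Transversal c f → Star g c 1 f a b t := by
    intro f hf
    obtain ⟨a', b', t', ca', cb', ma', mb', hS', hiff'⟩ := hX f hf
    -- An intermediate transversal: the window at `C_0` ignores the vertex in `C_4`, so the arc is
    -- still `ab`.
    have hf₁ := transversal_vec (hf₀ 0) (hf₀ 1) (hf₀ 2) (hf₀ 3) (hf 4)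
    obtain ⟨a₁, b₁, t₁, ca₁, cb₁, ma₁, mb₁, hS₁, hiff₁⟩ := hX _ hf₁
    have hF := transversal_vec ca cb (hf₀ 2) (hf₀ 3) (hf 4)
    have hFbad := (hiff _ hF rfl rfl).2 ⟨rfl, rfl⟩
    obtain ⟨e1, e2⟩ := (hiff₁ _ hF rfl rfl).1 hFbad
    have e1 : a = a₁ := e1
    have e2 : b = b₁ := e2
    subst e1 e2
    have hF' := transversal_vec ca' cb' (hf₀ 2) (hf 3) (hf 4)
    have hF'bad : cyc g ![a', b', f₀ 2, f 3, f 4] ≠ -1 :=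
      (hS'.cyc_ne_iff hF' rfl rfl).2 ⟨by rw [ca']; rfl, by rw [cb']; rfl⟩
    have h3 : (a', b') ≠ (a, b) → f 3 ≠ f₀ 3 := by
      intro hn h3
      rw [h3] at hF' hF'bad
      obtain ⟨e1, e2⟩ := (hiff₁ _ hF' rfl rfl).1 hF'bad
      exact hn (Prod.ext e1 e2)
    -- If exactly one end changes, the two exceptional cycles differ at it and in `C_3`,
    -- contradicting `false_of_agree`; if both change, the triangle `uvw` has four vertices.
    have hab : a' = a ∧ b' = b := by
      by_contra hn
      have h3 := h3 fun e => hn (Prod.mk.inj e)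
      by_cases ea : a' = a
      · have eb : b' ≠ b := fun e => hn ⟨ea, e⟩
        exact h.false_of_agree 2 hF hF' hFbad hF'bad rfl ea eb h3
      by_cases eb : b' = b
      · exact h.false_of_agree 4 hF hF' hFbad hF'bad eb rfl h3 ea
      · have h01 : ∀ {x y}, c x = 0 → c y = 1 → x ≠ y := fun h1 h2 =>
          hne (by rw [h1, h2]; decide)
        exact not_four_mem ma' mb' ma mb (h01 ca' cb') ea (h01 ca' cb) (h01 ca cb').symm eb
          (h01 ca cb)
    obtain ⟨rfl, rfl⟩ := hab
    have ht : t' = t := by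
      rw [← hS.tri_eq_gain (i := 0) (Or.inr rfl) (.of_left ca) (.of_right cb) hpx hxa hxb,
        hS'.tri_eq_gain (i := 0) (Or.inr rfl) (.of_left ca) (.of_right cb) hpx hxa hxb]
    rw [← ht]
    exact hS'
  refine ⟨a, b, t, ca, cb, hS.gain, ⟨x, hpx, hxa, hxb⟩, ?_, ?_⟩
  · intro i hi u' v' w' hu' hv' hw'
    rcases hi with rfl | rfl | rfl
    · have hb : ∀ y, InPair c 4 y → y ≠ b := by
        intro y hy
        refine hne ?_
        rw [cb]
        rcases hy with hy | hy <;> rw [hy] <;> decide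
      rw [tri_edgeGain_eq_one (Or.inr ⟨hb _ hu', hb _ hv', hb _ hw'⟩)]
      by_contra hn
      exact hcyc (h.cyc_eq_of_tri_ne (i := 4) (j := 0) rfl hu' hv' hw' hn hu hv hw hT hf₀)
    · exact hS.tri_eq 0 (Or.inr rfl) _ _ _ hu' hv' hw'
    · exact hS.tri_eq 1 (Or.inl rfl) _ _ _ hu' hv' hw'
  · intro f hf
    rw [(hstar f hf).cyc_eq f hf rfl rfl]
    have h2a : ∀ x, c x = 0 ∨ c x = 1 → f 2 ≠ x := fun x hx => hne (by
      rw [hf]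
      rcases hx with hx | hx <;> rw [hx] <;> decide)
    change -tri (edgeGain a b t) (f 0) (f 1) (f 2) = _
    rw [tri, edgeGain_eq_one (u := f 1) (Or.inl ⟨hne (by rw [hf, ca]; decide),
      h2a a (Or.inl ca)⟩), edgeGain_eq_one (u := f 2) (Or.inr ⟨h2a b (Or.inr cb),
      hne (by rw [hf, cb]; decide)⟩), mul_one, mul_one]

/-- The remaining two pairs of consecutive cliques are balanced. -/
theorem crossing_edge_tri_eq (hg : IsGain g) (hloc : ∀ k, LocalStar g fun v => c v - k)
    {f₀ : Fin 5 → V} (hf₀ : Transversal c f₀) {a b : V} {t : ℂ} (ca : c a = 0) (cb : c b = 1)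
    (ht : t = omega ∨ t = 1 - omega) (hx : ∃ x, InPair c 0 x ∧ x ≠ a ∧ x ≠ b)
    (hcyc : ∀ f, Transversal c f → cyc g f = -edgeGain a b t (f 0) (f 1)) {i : Fin 5}
    (hi : i = 2 ∨ i = 3) {u v w : V} (hu : InPair c i u) (hv : InPair c i v)
    (hw : InPair c i w) : tri g u v w = tri (edgeGain a b t) u v w := by
  have hne : ∀ {x y}, c x ≠ c y → x ≠ y := fun hxy e => hxy (congrArg c e)
  have hna : ∀ y, InPair c i y → y ≠ a := by
    intro y hy
    refine hne ?_
    rw [ca]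
    rcases hi with rfl | rfl <;> rcases hy with hy | hy <;> rw [hy] <;> decide
  rw [tri_edgeGain_eq_one (Or.inl ⟨hna _ hu, hna _ hv, hna _ hw⟩)]
  by_contra hT
  have hab : a ≠ b := hne (by rw [ca, cb]; decide)
  have hbadiff : ∀ f, Transversal c f → (cyc g f ≠ -1 ↔ f 0 = a ∧ f 1 = b) := by
    intro f hf
    rw [hcyc f hf, Ne, neg_inj]
    constructor
    · intro hn
      by_contra h
      refine hn ?_
      rw [edgeGain, if_neg h, if_neg]
      rintro ⟨h0, -⟩
      have := hf 0
      rw [h0, cb] at this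
      exact absurd this (by decide)
    · intro h
      rw [edgeGain, if_pos h]
      exact ne_one_of_cases ht
  have hF := transversal_vec ca cb (hf₀ 2) (hf₀ 3) (hf₀ 4)
  obtain ⟨a', b', t', ca', cb', ht', -, -, hcyc'⟩ := (hloc i).exists_crossing_edge hg
    (by simpa using hu.shift i) (by simpa using hv.shift i) (by simpa using hw.shift i) hT
    ⟨_, hF.shift i, by rw [cyc_add]; exact (hbadiff _ hF).2 ⟨rfl, rfl⟩⟩
  have hcyc'' : ∀ f, Transversal c f → cyc g f = -edgeGain a' b' t' (f i) (f (i + 1)) := by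
    intro f hf
    rw [← cyc_add f i, hcyc' _ (hf.shift i), zero_add, add_comm 1 i]
  have ca' : c a' = i := sub_eq_zero.1 ca'
  have cb' : c b' = i + 1 := by rw [← sub_add_cancel (c b') i, cb', add_comm]
  -- A 5-cycle through both arcs is exceptional. Replacing `a` or `b` by `x` keeps it exceptional
  -- according to `a'b'`, but not according to `ab`.
  obtain ⟨f, hf, f0, f1, f2, f3⟩ : ∃ f, Transversal c f ∧ f 0 = a ∧ f 1 = b ∧ f i = a' ∧
      f (i + 1) = b' := by
    rcases hi with rfl | rfl
    · exact ⟨_, transversal_vec ca cb ca' cb' (hf₀ 4), rfl, rfl, rfl, rfl⟩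
    · exact ⟨_, transversal_vec ca cb (hf₀ 2) ca' cb', rfl, rfl, rfl, rfl⟩
  obtain ⟨x, hpx, hxa, hxb⟩ := hx
  have hf' := hf.update x
  have hxi : i ≠ c x ∧ i + 1 ≠ c x := by
    rcases hi with rfl | rfl <;> rcases hpx with hx | hx <;> rw [hx] <;> decide
  have e1 : cyc g (Function.update f (c x) x) = cyc g f := by
    rw [hcyc'' _ hf', hcyc'' _ hf, Function.update_of_ne hxi.1, Function.update_of_ne hxi.2]
  have e2 := (hbadiff f hf).2 ⟨f0, f1⟩
  rw [← e1] at e2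
  obtain ⟨g0, g1⟩ := (hbadiff _ hf').1 e2
  rcases hpx with hx | hx
  · rw [hx, Function.update_self] at g0
    exact hxa g0
  · rw [hx, zero_add, Function.update_self] at g1
    exact hxb g1

end Crossing

/-- A gain function on a clique expansion of the 5-cycle with the local structure of `LocalStar`
is balanced on every pair of consecutive cliques up to one edge `ab`. -/
theorem exists_edge_of_localStar {V : Type*} [DecidableEq V] {g : V → V → ℂ} {c : V → Fin 5}
    (hg : IsGain g) (hloc : ∀ k, LocalStar g fun v => c v - k) {f₀ : Fin 5 → V}
    (hf₀ : Transversal c f₀) {i : Fin 5} {u v w : V} (hu : InPair c i u) (hv : InPair c i v)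
    (hw : InPair c i w) (hT : tri g u v w ≠ 1) :
    ∃ k a b t, a ≠ b ∧ (t = omega ∨ t = 1 - omega) ∧ c a = k ∧ (c b = k ∨ c b = k + 1) ∧
      (∀ i, ∀ u v w, InPair c i u → InPair c i v → InPair c i w →
        tri g u v w = tri (edgeGain a b t) u v w) ∧
      ∀ f, Transversal c f → cyc g f = -edgeGain a b t (f k) (f (k + 1)) := by
  have h : LocalStar g c := by simpa using hloc 0
  by_cases hall : ∀ f, Transversal c f → cyc g f = -1
  · obtain ⟨k, -, a, b, t, hS, ca, cb⟩ := h.exists_center hf₀ hall hu hv hw hT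
    refine ⟨k, a, b, t, hS.ne, hS.gain, ca, Or.inl cb, h.tri_eq_of_center hf₀ hall hS ca cb,
      fun f hf => ?_⟩
    have key : ∀ k : Fin 5, k + 1 ≠ k := by decide
    have hn : ∀ y, c y = k → f (k + 1) ≠ y := fun y hy e => key k (by rw [← hf (k + 1), e, hy])
    rw [hall f hf, edgeGain, if_neg fun e => hn b cb e.2, if_neg fun e => hn a ca e.2]
  · push Not at hall
    obtain ⟨f₁, hf₁, hbad⟩ := hall
    have hloc' : ∀ k, LocalStar g fun v => c v - i - k := fun k => by
      simpa only [sub_sub] using hloc (i + k)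
    obtain ⟨a, b, t, ca, cb, ht, hx, htri, hcyc⟩ := (hloc i).exists_crossing_edge hg
      (by simpa using hu.shift i) (by simpa using hv.shift i) (by simpa using hw.shift i) hT
      ⟨_, hf₁.shift i, by rw [cyc_add]; exact hbad⟩
    refine ⟨i, a, b, t, ?_, ht, sub_eq_zero.1 ca, Or.inr ?_, ?_, ?_⟩
    · rintro rfl
      rw [ca] at cb
      exact absurd cb (by decide)
    · rw [← sub_add_cancel (c b) i, cb, add_comm]
    · intro l u v w hu hv hw
      have hu := hu.shift i
      have hv := hv.shift i
      have hw := hw.shift i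
      generalize l - i = m at hu hv hw
      have key : ∀ m : Fin 5, (m = 4 ∨ m = 0 ∨ m = 1) ∨ (m = 2 ∨ m = 3) := by decide
      rcases key m with hm | hm
      · exact htri m hm u v w hu hv hw
      · exact crossing_edge_tri_eq hg hloc' (hf₀.shift i) ca cb ht hx hcyc hm hu hv hw
    · intro f hf
      rw [← cyc_add f i, hcyc _ (hf.shift i), zero_add, add_comm 1 i]


/-! ### Switching to a normal form. -/

section Switching

variable {V : Type*} {g : V → V → ℂ} {c : V → Fin 5}

theorem IsGain.mul_eq_of_tri (hg : IsGain g) {u v w : V} (h : tri g u v w = 1) :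
    g u v * g v w = g u w := by
  rw [tri] at h
  linear_combination g u w * h - g u v * g v w * hg.inv w u

theorem exists_potential_last {e : Fin 5 → ℂ} (he : ∀ i, e i ∈ gainSet) :
    ∃ P : Fin 5 → ℂ, (∀ i, P i ∈ gainSet) ∧
      ∀ i, P i * e i = (if i = 4 then ∏ m, e m else 1) * P (i + 1) := by
  have h2 := mul_mem_gainSet (he 0) (he 1)
  have h3 := mul_mem_gainSet h2 (he 2)
  have h4 := mul_mem_gainSet h3 (he 3)
  refine ⟨![1, e 0, e 0 * e 1, e 0 * e 1 * e 2, e 0 * e 1 * e 2 * e 3], fun i => ?_,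
    fun i => ?_⟩
  · fin_cases i
    exacts [one_mem_gainSet, he 0, h2, h3, h4]
  · fin_cases i <;> simp [Fin.prod_univ_five]

/-- A potential along the 5-cycle that concentrates the total gain at the index `k`. -/
theorem exists_potential {e : Fin 5 → ℂ} (he : ∀ i, e i ∈ gainSet) (k : Fin 5) :
    ∃ P : Fin 5 → ℂ, (∀ i, P i ∈ gainSet) ∧
      ∀ i, P i * e i = (if i = k then ∏ m, e m else 1) * P (i + 1) := by
  obtain ⟨P, hP, h⟩ := exists_potential_last (e := fun i => e (i + (k + 1))) fun i => he _
  refine ⟨fun i => P (i - (k + 1)), fun i => hP _, fun i => ?_⟩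
  have h1 := h (i - (k + 1))
  have key : ∀ i k : Fin 5, i - (k + 1) = 4 ↔ i = k := by decide
  rw [sub_add_cancel, if_congr (key i k) rfl rfl, ← add_sub_right_comm] at h1
  rw [h1, ← Equiv.prod_comp (Equiv.addRight (k + 1)) e]
  rfl

theorem crossGain_succ {k : Fin 5} {z : ℂ} {u v : V} (h : c v = c u + 1) :
    crossGain c k z u v = if c u = k then z else 1 := by
  have key : ∀ k : Fin 5, k ≠ k + 1 + 1 := by decide
  unfold crossGain
  by_cases hu : c u = k
  · rw [if_pos ⟨hu, by rw [h, hu]⟩, if_pos hu]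
  · rw [if_neg fun e => hu e.1, if_neg hu, if_neg]
    rintro ⟨h1, h2⟩
    rw [h, h1] at h2
    exact key k h2.symm

theorem crossGain_self {k : Fin 5} {z : ℂ} {u v : V} (h : c u = c v) :
    crossGain c k z u v = 1 := by
  have key : ∀ k : Fin 5, k ≠ k + 1 := by decide
  unfold crossGain
  rw [if_neg fun e => key k (e.1.symm.trans (h.trans e.2)),
    if_neg fun e => key k (e.2.symm.trans (h.symm.trans e.1))]

theorem crossGain_inv (k : Fin 5) (z : ℂ) (u v : V) :
    (crossGain c k z u v)⁻¹ = crossGain c k z⁻¹ u v := by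
  unfold crossGain
  split_ifs <;> simp

theorem crossGain_swap (k : Fin 5) (z : ℂ) (u v : V) :
    (crossGain c k z u v)⁻¹ = crossGain c k z v u := by
  have key : ∀ k : Fin 5, k ≠ k + 1 := by decide
  unfold crossGain
  by_cases h1 : c u = k ∧ c v = k + 1
  · have h2 : ¬(c v = k ∧ c u = k + 1) := fun h => key k (h1.1.symm.trans h.2)
    rw [if_pos h1, if_neg h2, if_pos h1.symm]
  · by_cases h2 : c u = k + 1 ∧ c v = k
    · rw [if_neg h1, if_pos h2, if_pos h2.symm, inv_inv]
    · rw [if_neg h1, if_neg h2, if_neg fun h => h2 h.symm, if_neg fun h => h1 h.symm, inv_one]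

/-- If every pair of consecutive cliques is balanced, then the gains can be switched so that the
gain of the 5-cycles is concentrated between `C_k` and `C_{k+1}`. -/
theorem IsGain.exists_switching (hg : IsGain g)
    (hbal : ∀ i u v w, InPair c i u → InPair c i v → InPair c i w → tri g u v w = 1)
    {f : Fin 5 → V} (hf : Transversal c f) (k : Fin 5) :
    ∃ x : V → ℂ, (∀ v, x v ∈ gainSet) ∧
      ∀ u v, (c u = c v ∨ c v = c u + 1 ∨ c u = c v + 1) →
        x u * g u v * (x v)⁻¹ = crossGain c k (cyc g f) u v := by
  obtain ⟨P, hP, h⟩ := exists_potential (e := fun i => g (f i) (f (i + 1)))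
    (fun i => hg.mem _ _) k
  -- Potential along a spanning tree: `P` follows the base 5-cycle `f`, then one arc leads from the
  -- base vertex of the clique to `v`.
  let x : V → ℂ := fun v => P (c v) * g (f (c v)) v
  have hx : ∀ v, x v ∈ gainSet := fun v => mul_mem_gainSet (hP _) (hg.mem _ _)
  have hx0 : ∀ v, x v ≠ 0 := fun v => ne_zero_of_mem_gainSet (hx v)
  have hsucc : ∀ u v, c v = c u + 1 →
      x u * g u v * (x v)⁻¹ = crossGain c k (cyc g f) u v := by
    intro u v huv
    have pu : InPair c (c u) u := Or.inl rfl
    have pv : InPair c (c u) v := Or.inr huv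
    have pf : InPair c (c u) (f (c u)) := Or.inl (hf _)
    have pf' : InPair c (c u) (f (c u + 1)) := Or.inr (hf _)
    have e1 := hg.mul_eq_of_tri (hbal _ _ _ _ pf pu pv)
    have e2 := hg.mul_eq_of_tri (hbal _ _ _ _ pf pf' pv)
    have e3 := h (c u)
    change P (c u) * g (f (c u)) (f (c u + 1)) = (if c u = k then cyc g f else 1) * _ at e3
    rw [mul_inv_eq_iff_eq_mul₀ (hx0 v), crossGain_succ huv]
    simp only [x, huv]
    linear_combination P (c u) * e1 - P (c u) * e2 + g (f (c u + 1)) v * e3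
  refine ⟨x, hx, fun u v huv => ?_⟩
  rcases huv with huv | huv | huv
  · have pu : InPair c (c u) u := Or.inl rfl
    have pv : InPair c (c u) v := Or.inl huv.symm
    have pf : InPair c (c u) (f (c u)) := Or.inl (hf _)
    have e1 := hg.mul_eq_of_tri (hbal _ _ _ _ pf pu pv)
    rw [mul_inv_eq_iff_eq_mul₀ (hx0 v), crossGain_self huv]
    simp only [x, ← huv]
    linear_combination P (c u) * e1
  · exact hsucc u v huv
  · rw [← crossGain_swap, ← hsucc v u huv, mul_inv (x v * g v u),
      mul_inv (x v) (g v u), inv_inv, inv_eq_of_mul_eq_one_right (hg.inv v u)]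
    ring

end Switching

theorem IsExpansion.shift {V : Type*} {G : SimpleGraph V} {c : V → Fin 5} (hc : IsExpansion G c) (k : Fin 5) :
    IsExpansion G fun v => c v - k := by
  intro u v
  rw [hc]
  simp only [← add_sub_right_comm, sub_left_inj]

theorem isExpansion_of_iso {V : Type*} {G : SimpleGraph V} {τ : Fin 5 → ℕ}
    (e : G ≃g cliqueExpansion (SimpleGraph.cycleGraph 5) τ) :
    IsExpansion G fun v => (e v).1 := by
  intro u v
  have key : ∀ i j : Fin 5, (i = j ∨ (SimpleGraph.cycleGraph 5).Adj i j) ↔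
      (i = j ∨ j = i + 1 ∨ i = j + 1) := by decide
  rw [← e.map_adj_iff]
  change (e u ≠ e v ∧ _) ↔ _
  rw [key, e.injective.ne_iff]

theorem tri_edgeGain_cases {V : Type*} [DecidableEq V] {a b : V} {t : ℂ} (hab : a ≠ b) (ht : t = omega ∨ t = 1 - omega)
    (u v w : V) : tri (edgeGain a b t) u v w = 1 ∨ tri (edgeGain a b t) u v w = omega ∨
      tri (edgeGain a b t) u v w = 1 - omega := by
  have he := isGain_edgeGain hab (mem_gainSet_of_cases ht)
  by_cases h : tri (edgeGain a b t) u v w = 1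
  · exact Or.inl h
  obtain ⟨ha, hb⟩ := mem_of_tri_edgeGain_ne h
  refine tri_induction (a := a) (b := b) (P := fun u v w => tri (edgeGain a b t) u v w = 1 ∨
    tri (edgeGain a b t) u v w = omega ∨ tri (edgeGain a b t) u v w = 1 - omega)
    (fun u v w h => by rwa [← tri_rotate]) (fun u v w h => ?_) hab (fun w => ?_) ha hb
  · rw [← he.star_tri]
    rcases h with h | h | h
    · exact Or.inl (by rw [h, star_one])
    · exact Or.inr (Or.inr (by rw [h, star_omega]))
    · exact Or.inr (Or.inl (by rw [h, star_sub, star_one, star_omega]; ring))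
  · by_cases hwa : w = a
    · subst hwa; exact Or.inl (he.tri_outer _ _)
    by_cases hwb : w = b
    · subst hwb; exact Or.inl (he.tri_right _ _)
    rw [tri_edgeGain hab hwa hwb]
    exact Or.inr ht

theorem LocalStar.cyc_cases {V : Type*} [DecidableEq V] {g : V → V → ℂ} {c : V → Fin 5} (h : LocalStar g c)
    {f : Fin 5 → V} (hf : Transversal c f) :
    cyc g f = -1 ∨ cyc g f = -omega ∨ cyc g f = -(1 - omega) := by
  rcases h 0 f hf with h | ⟨a, b, t, hS⟩
  · exact Or.inl (h.2 f hf rfl rfl)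
  · rw [hS.cyc_eq f hf rfl rfl, neg_inj, neg_inj, neg_inj]
    exact tri_edgeGain_cases hS.ne hS.gain _ _ _

/-! ### Recognition of the four types. -/

section Final

variable {V : Type*} [Fintype V] [DecidableEq V] {G : SimpleGraph V} [DecidableRel G.Adj]

/-- Switching a signature by `x`. -/
noncomputable def Signature.switch (φ : Signature G) (x : V → ℂ) (hx : ∀ v, x v ∈ gainSet) :
    Signature G where
  gain u v := x u * φ.gain u v * (x v)⁻¹
  gain_mem u v h :=
    mul_mem_gainSet (mul_mem_gainSet (hx u) (φ.gain_mem u v h)) (inv_mem_gainSet (hx v))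
  gain_inv u v h := by
    rw [φ.gain_inv u v h, mul_inv, mul_inv, inv_inv]
    ring

/-- The converse of a signature. -/
noncomputable def Signature.converse (φ : Signature G) : Signature G where
  gain u v := φ.gain v u
  gain_mem u v h := φ.gain_mem v u h.symm
  gain_inv u v h := φ.gain_inv v u h.symm

theorem Signature.isGainSwitching_switch (φ : Signature G) (x : V → ℂ)
    (hx : ∀ v, x v ∈ gainSet) : IsGainSwitching φ.eisenstein (φ.switch x hx).eisenstein := by
  refine ⟨x, hx, ?_⟩
  have hinv : (Matrix.diagonal x)⁻¹ = Matrix.diagonal fun v => (x v)⁻¹ := by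
    refine Matrix.inv_eq_right_inv ?_
    rw [Matrix.diagonal_mul_diagonal, ← Matrix.diagonal_one]
    exact congrArg _ (funext fun v => mul_inv_cancel₀ (ne_zero_of_mem_gainSet (hx v)))
  ext u v
  rw [hinv, Matrix.mul_diagonal, Matrix.diagonal_mul]
  by_cases h : G.Adj u v <;> simp [eisenstein, switch, h]

theorem Signature.exists_switching (φ : Signature G) (x : V → ℂ) (hx : ∀ v, x v ∈ gainSet) :
    ∃ φ' : Signature G, SwitchingIsomorphic φ φ' ∧
      ∀ u v, G.Adj u v → φ'.gain u v = x u * φ.fullGain u v * (x v)⁻¹ :=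
  ⟨φ.switch x hx, ⟨1, Or.inl (φ.isGainSwitching_switch x hx)⟩, fun u v h => by
    rw [fullGain, if_pos h]; rfl⟩

theorem Signature.exists_switching_converse (φ : Signature G) (x : V → ℂ)
    (hx : ∀ v, x v ∈ gainSet) : ∃ φ' : Signature G, SwitchingIsomorphic φ φ' ∧
      ∀ u v, G.Adj u v → φ'.gain u v = (x u * φ.fullGain u v * (x v)⁻¹)⁻¹ := by
  refine ⟨(φ.switch x hx).converse, ⟨1, Or.inr ?_⟩, fun u v h => ?_⟩
  · have : (φ.switch x hx).converse.eisenstein.transpose = (φ.switch x hx).eisenstein := by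
      ext u v
      simp [eisenstein, converse, G.adj_comm]
    rw [this]
    exact φ.isGainSwitching_switch x hx
  · rw [fullGain, if_pos h]
    exact (φ.switch x hx).gain_inv v u h.symm

variable {c : V → Fin 5} {φ : Signature G}

theorem exists_typeA_or_typeC (hc : IsExpansion G c) (hloc : LocalStar φ.fullGain c)
    {f : Fin 5 → V} (hf : Transversal c f)
    (hbal : ∀ i u v w, InPair c i u → InPair c i v → InPair c i w →
      tri φ.fullGain u v w = 1) :
    ∃ φ' : Signature G, SwitchingIsomorphic φ φ' ∧ (φ'.IsTypeA c ∨ φ'.IsTypeC c) := by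
  obtain ⟨x, hx, h⟩ := φ.isGain_fullGain.exists_switching hbal hf 0
  rcases hloc.cyc_cases hf with hz | hz | hz <;> rw [hz] at h
  · obtain ⟨φ', hiso, hφ'⟩ := φ.exists_switching x hx
    exact ⟨φ', hiso, Or.inl ⟨0, fun u v huv => by
      rw [hφ' u v huv, h u v ((hc u v).1 huv).2]⟩⟩
  · obtain ⟨φ', hiso, hφ'⟩ := φ.exists_switching x hx
    exact ⟨φ', hiso, Or.inr ⟨0, fun u v huv => by
      rw [hφ' u v huv, h u v ((hc u v).1 huv).2]⟩⟩
  -- The converse turns the cycle gain `-ω⁻¹` into `-ω`.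
  · obtain ⟨φ', hiso, hφ'⟩ := φ.exists_switching_converse x hx
    exact ⟨φ', hiso, Or.inr ⟨0, fun u v huv => by
      rw [hφ' u v huv, h u v ((hc u v).1 huv).2, crossGain_inv, inv_neg, one_sub_omega_inv]⟩⟩

theorem exists_typeB_or_typeD (hc : IsExpansion G c) {f : Fin 5 → V} (hf : Transversal c f)
    {k : Fin 5} {a b : V} {t : ℂ} (hab : a ≠ b) (ht : t = omega ∨ t = 1 - omega) (ha : c a = k)
    (hb : c b = k ∨ c b = k + 1)
    (htri : ∀ i u v w, InPair c i u → InPair c i v → InPair c i w →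
      tri φ.fullGain u v w = tri (edgeGain a b t) u v w)
    (hcyc : cyc φ.fullGain f = -edgeGain a b t (f k) (f (k + 1))) :
    ∃ φ' : Signature G, SwitchingIsomorphic φ φ' ∧ (φ'.IsTypeB c ∨ φ'.IsTypeD c) := by
  have hg := φ.isGain_fullGain
  have he := isGain_edgeGain hab (mem_gainSet_of_cases ht)
  set g := φ.fullGain
  -- Dividing out the exceptional arc leaves balanced pairs and cycle gain `-1`, which switches to
  -- type A; the arc is multiplied back afterwards.
  let g' : V → V → ℂ := fun u v => g u v * edgeGain a b t v u
  have hg' : IsGain g' :=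
    ⟨fun u => by simp only [g', hg.diag, he.diag, mul_one],
      fun u v => mul_mem_gainSet (hg.mem _ _) (he.mem _ _), fun u v => by
        simp only [g']
        linear_combination edgeGain a b t v u * edgeGain a b t u v * hg.inv u v + he.inv v u⟩
  have hbal : ∀ i u v w, InPair c i u → InPair c i v → InPair c i w → tri g' u v w = 1 := by
    intro i u v w hu hv hw
    have h1 : tri g' u v w = tri g u v w * tri (edgeGain a b t) u w v := by
      simp only [tri, g']
      ring
    rw [h1, htri i u v w hu hv hw, he.tri_mul_tri_swap]
  have hprod : cyc (edgeGain a b t) f = edgeGain a b t (f k) (f (k + 1)) := by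
    refine Finset.prod_eq_single k (fun i _ hik => ?_) (fun h => absurd (Finset.mem_univ k) h)
    have hcm : ∀ {m y}, f m = y → m = c y := fun {m y} h => by rw [← h, hf]
    have key : ∀ i k : Fin 5, i + 1 = k → ¬(i = k ∨ i = k + 1) := by decide
    rw [edgeGain, if_neg fun h => hik ((hcm h.1).trans ha), if_neg]
    rintro ⟨h1, h2⟩
    rw [← hcm h1] at hb
    exact key i k ((hcm h2).trans ha) hb
  have hcyc' : cyc g' f = -1 := by
    have h1 : cyc g' f * cyc (edgeGain a b t) f = cyc g f := by
      rw [cyc, cyc, cyc, ← Finset.prod_mul_distrib]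
      refine Finset.prod_congr rfl fun i _ => ?_
      simp only [g']
      linear_combination g (f i) (f (i + 1)) * he.inv (f (i + 1)) (f i)
    rw [hcyc, hprod] at h1
    have h0 := ne_zero_of_mem_gainSet (he.mem (f k) (f (k + 1)))
    exact mul_right_cancel₀ h0 (by rw [h1]; ring)
  obtain ⟨x, hx, h⟩ := hg'.exists_switching hbal hf k
  rw [hcyc'] at h
  have hsw : ∀ u v, G.Adj u v → x u * g u v * (x v)⁻¹ =
      crossGain c k (-1) u v * edgeGain a b t u v := by
    intro u v huv
    rw [← h u v ((hc u v).1 huv).2]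
    simp only [g']
    linear_combination -(x u * g u v * (x v)⁻¹) * he.inv u v
  rcases hb with hb | hb
  · have hB : ∀ a b : V, c a = k → c b = k → ∀ u v, crossGain c k (-1) u v * edgeGain a b omega u v
        = if u = a ∧ v = b then omega else if u = b ∧ v = a then omega⁻¹
          else crossGain c k (-1) u v := by
      intro a b ha hb u v
      unfold edgeGain
      split_ifs with h1 h2
      · rw [crossGain_self (by rw [h1.1, h1.2, ha, hb]), one_mul]
      · rw [crossGain_self (by rw [h2.1, h2.2, ha, hb]), one_mul]
      · rw [mul_one]
    obtain ⟨φ', hiso, hφ'⟩ := φ.exists_switching x hx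
    refine ⟨φ', hiso, Or.inl ?_⟩
    rcases ht with rfl | rfl
    · exact ⟨k, a, b, hab, ha, hb, fun u v huv => by
        rw [hφ' u v huv, hsw u v huv, hB a b ha hb]⟩
    -- Both ends lie in `C_k`, so gain `ω⁻¹` on `ab` is gain `ω` on `ba` and no converse is needed.
    · exact ⟨k, b, a, hab.symm, hb, ha, fun u v huv => by
        rw [hφ' u v huv, hsw u v huv, ← edgeGain_swap hab, one_sub_omega_inv, hB b a hb ha]⟩
  · have hD : ∀ u v, crossGain c k (-1) u v * edgeGain a b omega u v
        = if u = a ∧ v = b then -omega else if u = b ∧ v = a then (-omega)⁻¹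
          else crossGain c k (-1) u v := by
      have key : ∀ k : Fin 5, k + 1 ≠ k := by decide
      intro u v
      unfold edgeGain
      split_ifs with h1 h2
      · rw [crossGain, if_pos ⟨by rw [h1.1, ha], by rw [h1.2, hb]⟩]
        ring
      · rw [crossGain, if_neg, if_pos ⟨by rw [h2.1, hb], by rw [h2.2, ha]⟩, inv_neg, inv_neg,
          inv_one]
        · ring
        · rintro ⟨e, -⟩
          rw [h2.1, hb] at e
          exact key k e
      · rw [mul_one]
    have hinv : ∀ u v, (edgeGain a b t u v)⁻¹ = edgeGain a b t⁻¹ u v := by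
      intro u v
      unfold edgeGain
      split_ifs <;> simp
    rcases ht with rfl | rfl
    · obtain ⟨φ', hiso, hφ'⟩ := φ.exists_switching x hx
      exact ⟨φ', hiso, Or.inr ⟨k, a, b, ha, hb, fun u v huv => by
        rw [hφ' u v huv, hsw u v huv, hD]⟩⟩
    -- The ends lie in different cliques and cannot be interchanged; the converse replaces `ω⁻¹` by
    -- `ω` and keeps the gains `-1`.
    · obtain ⟨φ', hiso, hφ'⟩ := φ.exists_switching_converse x hx
      exact ⟨φ', hiso, Or.inr ⟨k, a, b, ha, hb, fun u v huv => by
        rw [hφ' u v huv, hsw u v huv, mul_inv, hinv, crossGain_inv, inv_neg, inv_one,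
          one_sub_omega_inv, hD]⟩⟩

end Final

end SignedDigraph

theorem mainTheorem8 {V : Type*} [Fintype V] [DecidableEq V] (G : SimpleGraph V)
    [DecidableRel G.Adj] (τ : Fin 5 → ℕ) (hτ : ∀ j, 1 ≤ τ j)
    (e : G ≃g SignedDigraph.cliqueExpansion (SimpleGraph.cycleGraph 5) τ)
    (φ : SignedDigraph.Signature G) (hφ : φ.SecondPosThirdNeg) :
    ∃ φ' : SignedDigraph.Signature G, SignedDigraph.SwitchingIsomorphic φ φ' ∧
      (φ'.IsTypeA (fun v => (e v).1) ∨ φ'.IsTypeB (fun v => (e v).1) ∨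
        φ'.IsTypeC (fun v => (e v).1) ∨ φ'.IsTypeD (fun v => (e v).1)) := by
  have hc := SignedDigraph.isExpansion_of_iso e
  have hf : SignedDigraph.Transversal (fun v => (e v).1) fun i => e.symm ⟨i, ⟨0, hτ i⟩⟩ := by
    intro i
    change (e (e.symm _)).1 = i
    rw [e.apply_symm_apply]
  set c : V → Fin 5 := fun v => (e v).1
  by_cases hbal : ∀ i u v w, SignedDigraph.InPair c i u → SignedDigraph.InPair c i v →
      SignedDigraph.InPair c i w → SignedDigraph.tri φ.fullGain u v w = 1
  · obtain ⟨φ', hiso, h⟩ := SignedDigraph.exists_typeA_or_typeC hc (hφ.localStar hc) hf hbal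
    exact ⟨φ', hiso, by tauto⟩
  · push Not at hbal
    obtain ⟨i, u, v, w, hu, hv, hw, hT⟩ := hbal
    obtain ⟨k, a, b, t, hab, ht, ha, hb, htri, hcyc⟩ := SignedDigraph.exists_edge_of_localStar
      φ.isGain_fullGain (fun k => hφ.localStar (hc.shift k)) hf hu hv hw hT
    obtain ⟨φ', hiso, h⟩ := SignedDigraph.exists_typeB_or_typeD hc hf hab ht ha hb htri
      (hcyc _ hf)
    exact ⟨φ', hiso, by tauto⟩
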